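/- \textbf{Setting.} Let $\mathcal H$ be a complex Hilbert space, $-\infty<a<b<\infty$, $0\in[a,b]$, and let $r\ge 1$ be an integer, $n=[r/2]$. All functions are considered on $[a,b]$, with one-sided derivatives at the end points; $D=d/dt$; $(\cdot,\cdot)$ is linear in the first argument. A differential expression of order $r$ is $$L=\sum_{k=0}^{r}i^kL_k,\qquad L_{2j}=D^jp_jD^j,\qquad L_{2j-1}=\tfrac12D^{j-1}\{Dq_j+s_jD\}D^{j-1},$$ with $p_j,q_j,s_j\in C^j([a,b],B(\mathcal H))$. Its adjoint $L^*$ has the coefficients $p_j^*,s_j^*,q_j^*$ in place of $p_j,q_j,s_j$; $\Re L=\frac12(L+L^*)$, $\Im L=\frac1{2i}(L-L^*)$. Its form at $t$ is $$L\langle h,g\rangle=\sum_{j=0}^{[r/2]}(p_jh_j,g_j)+\tfrac i2\sum_{j=1}^{[(r+1)/2]}\big\{(s_jh_j,g_{j-1})-(q_jh_{j-1},g_j)\big\},$$ and $L\{f,g\}=L\langle (f^{(j)})_j,(g^{(j)})_j\rangle$. The leading coefficient of $L$ is called invertible if $p_n^{-1}\in B(\mathcal H)$ (for $r=2n$), resp.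 $(q_{n+1}+s_{n+1})^{-1}\in B(\mathcal H)$ (for $r=2n+1$), for all $t\in[a,b]$. The quasi-derivatives of $y$ for $L$ are (with $q_0:=0$) $y^{[j]}=y^{(j)}$ for $j<n$; $y^{[n]}=p_ny^{(n)}-\frac i2q_ny^{(n-1)}$ if $r=2n$, and $y^{[n]}=-\frac i2q_{n+1}y^{(n)}$ if $r=2n+1$; and $$y^{[r-j]}=-Dy^{[r-j-1]}+p_jy^{(j)}+\tfrac i2\big[s_{j+1}y^{(j+1)}-q_jy^{(j-1)}\big],\qquad 0\le j\le[\tfrac{r-1}2].$$ Let $l_\lambda=l-\lambda m-n_\lambda$ be a family of expressions of order $r$ and let $\mathcal B\supseteq\mathbb C\setminus\mathbb R$ be a set such that: every point of $\mathcal B$ has a neighbourhood, independent of $t$, in which the coefficients of $l_\lambda$ are analytic in $\lambda$ for all $t\in[a,b]$; for $\lambda\in\mathcal B$ the coefficients of $l_\lambda$ belong to the classes $C^j$ above, the leading coefficient of $l_\lambda$ is invertible and $l_\lambda=l_{\bar\lambda}^*$; and $\Im (l_\lambda\langle h,h\rangle)/\Im\lambda\le0$ for $\Im\lambda\ne0$,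 $t\in[a,b]$ and all $h$. Let $m=m^*$ be an expression of even order $s\le r$ (same smoothness, coefficients independent of $\lambda$) with $$0\le m\langle h,h\rangle\le-\Im (l_\lambda\langle h,h\rangle)/\Im\lambda\qquad(t\in[a,b],\ \Im\lambda\ne0,\ \text{all }h),$$ and let $l=\Re l_{i}$ (here $i=\sqrt{-1}$). For $y\in C^r([a,b],\mathcal H)$, $f\in C^s([a,b],\mathcal H)$ put, with $f^{[k]}(\cdot|m):=0$ for $k<s/2$, $$\vec y(t,L,m,f)=\Big(y,\dots,y^{(n-1)},\ \big(y^{[r-j]}(t|L)-f^{[s-j]}(t|m)\big)_{j=1}^{n}\Big)\in\mathcal H^r\quad(r=2n),$$ with the additional last component $-iy^{(n)}$ if $r=2n+1>1$, and $\vec y=y$ if $r=1$. Put $Q(t,L)=\begin{pmatrix}0&iI_n\\-iI_n&0\end{pmatrix}$ if $r=2n$, $Q(t,L)=\begin{pmatrix}0&iI_n\\-iI_n&0\end{pmatrix}\oplus q_{n+1}(t)$ if $r=2n+1$ (so $Q=q_1$ if $r=1$), and $\Re Q=\frac12(Q+Q^*)$. We say that a family $L_\lambda$ satisfies \emph{condition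 (55) with $P=I_r$} relative to a set $\mathcal S\subseteq\mathbb C$ if there are $\lambda_0\in\mathcal S$, $\alpha,\beta\in[a,b]$ with $0\in[\alpha,\beta]$, and $\delta>0$ such that $$-\int_\alpha^\beta\Big(\frac{\Im L_{\lambda_0}}{\Im\lambda_0}\Big)\{y,y\}\,dt\ \ge\ \delta\,\|\vec y(0,L_{\lambda_0},m,0)\|^2$$ for every solution $y\in C^r([a,b],\mathcal H)$ of $L_{\lambda_0}[y]=0$ on $[a,b]$; for real $\lambda_0$, $\Im L_{\lambda_0}/\Im\lambda_0$ means $\partial L_\lambda/\partial\lambda|_{\lambda=\lambda_0}$. \textbf{Proposition.} Let $\mathcal B_0\supseteq\mathbb C\setminus\mathbb R$ be a set such that $l-\lambda m$, as an expression of order $r$, has an invertible leading coefficient for all $\lambda\in\mathcal B_0$ (so that the order of $n_\lambda$ does not exceed the order $r$ of $l-\lambda m$). Suppose that the unperturbed family $l-\lambda m$ (that is, $n_\lambda\equiv0$) satisfies condition (55) with $P=I_r$ relative to $\mathcal B_0$. Then: 1. The perturbed family $l_\lambda=l-\lambda m-n_\lambda$ satisfies condition (55) with $P=I_r$ relative to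 $\mathcal B$. 2. Let $\mathcal M_\lambda,\mathcal N_\lambda\in B(\mathcal H^r)$ be analytic in $\lambda\in\mathbb C\setminus\mathbb R$ and such that, for $\Im\lambda\ne0$: $\mathcal M_{\bar\lambda}^*[\Re Q(a,l_\lambda)]\mathcal M_\lambda=\mathcal N_{\bar\lambda}^*[\Re Q(b,l_\lambda)]\mathcal N_\lambda$; $\|\mathcal M_\lambda h\|+\|\mathcal N_\lambda h\|>0$ for $0\ne h\in\mathcal H^r$; and $\{\mathcal M_\lambda h\oplus\mathcal N_\lambda h: h\in\mathcal H^r\}\subset\mathcal H^{2r}$ is a maximal nonnegative subspace for the form of $(\Im\lambda)\,\mathrm{diag}(\Re Q(a,l_\lambda),-\Re Q(b,l_\lambda))$. Let $\Im\lambda\ne0$, $f\in C^s([a,b],\mathcal H)$, and let $y=R_\lambda f$, $y_1=R(\lambda)f$ be the values of resolvents given by the boundary problems with these operators for the unperturbed and the perturbed equation; that is, let $y,y_1\in C^r([a,b],\mathcal H)$ be any functions with $$(l-\lambda m)[y]=m[f],\quad \exists h\in\mathcal H^r:\ \vec y(a,l-\lambda m,m,f)=\mathcal M_\lambda h,\ \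 \vec y(b,l-\lambda m,m,f)=\mathcal N_\lambda h,$$ $$l_\lambda[y_1]=m[f],\quad \exists h_1\in\mathcal H^r:\ \vec y_1(a,l_\lambda,m,f)=\mathcal M_\lambda h_1,\ \ \vec y_1(b,l_\lambda,m,f)=\mathcal N_\lambda h_1.$$ Then, with $\vec z(t)=\vec y_1(t,l_\lambda,m,f)-\vec y(t,l-\lambda m,m,f)$, the limit below exists and condition (94) holds: $$\lim_{\alpha\downarrow a,\ \beta\uparrow b}\ \frac{(\Re Q(t,l_\lambda)\vec z(t),\vec z(t))}{\Im\lambda}\Big|_{t=\alpha}^{t=\beta}\ \le\ 0 .$$ -/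

import Mathlib

open Set Filter Topology
open scoped ComplexConjugate

/-- Coefficients `p j`, `q j`, `s j` (functions of `t`, values in `B(H)`) of a differential expression
`∑ i^k l_k`, `l_{2j} = D^j p_j D^j`, `l_{2j-1} = ½ D^{j-1} {D q_j + s_j D} D^{j-1}`.
The formal order `r` is always given separately: only `p j` with `2 j ≤ r` and `q j`, `s j` with
`1 ≤ j`, `2 j ≤ r + 1` are ever used, so `q 0` and `s 0` are irrelevant. -/
structure DiffExpr (H : Type*) [NormedAddCommGroup H] [InnerProductSpace ℂ H] where
  p : ℕ → ℝ → (H →L[ℂ] H)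
  q : ℕ → ℝ → (H →L[ℂ] H)
  s : ℕ → ℝ → (H →L[ℂ] H)

/-- The Hilbert space `H^r` with its Hilbert norm. -/
abbrev HilbPow (H : Type*) [NormedAddCommGroup H] [InnerProductSpace ℂ H] (r : ℕ) : Type _ :=
  PiLp 2 (fun _ : Fin r => H)

noncomputable section

namespace DiffExpr

variable {H : Type*} [NormedAddCommGroup H] [InnerProductSpace ℂ H]

instance : Zero (DiffExpr H) := ⟨⟨fun _ _ => 0, fun _ _ => 0, fun _ _ => 0⟩⟩

/-- The expression `l_z = l - z m - n_z`. -/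
def pencil (l m : DiffExpr H) (n : ℂ → DiffExpr H) (z : ℂ) : DiffExpr H where
  p j t := l.p j t - z • m.p j t - (n z).p j t
  q j t := l.q j t - z • m.q j t - (n z).q j t
  s j t := l.s j t - z • m.s j t - (n z).s j t

/-- The value `L[y](t)` of the expression `L` of order `r` on a function `y` on the interval `J`
(one-sided derivatives at the end points). -/
def apply (L : DiffExpr H) (r : ℕ) (J : Set ℝ) (y : ℝ → H) (t : ℝ) : H :=
  ∑ j ∈ Finset.range (r / 2 + 1),
      (Complex.I ^ (2 * j)) •
        iteratedDerivWithin j (fun u => L.p j u (iteratedDerivWithin j y J u)) J t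
    + ∑ j ∈ Finset.Icc 1 ((r + 1) / 2),
      (Complex.I ^ (2 * j - 1) * (1 / 2)) •
        iteratedDerivWithin (j - 1)
          (fun u => derivWithin (fun v => L.q j v (iteratedDerivWithin (j - 1) y J v)) J u
            + L.s j u (iteratedDerivWithin j y J u)) J t

/-- The quasi-derivatives `y^{[k]}(t|L)`, `0 ≤ k ≤ r`, of `y` for the expression `L` of order `r`:
with `n = [r/2]`,
`y^{[k]} = y^{(k)}` for `k < n`,
`y^{[n]} = p_n y^{(n)} - (i/2) q_n y^{(n-1)}` if `r = 2n`, `y^{[n]} = -(i/2) q_{n+1} y^{(n)}` if `r = 2n+1`,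
`y^{[r-j]} = -(y^{[r-j-1]})' + p_j y^{(j)} + (i/2) (s_{j+1} y^{(j+1)} - q_j y^{(j-1)})`
for `r - j > n`, with the convention `q_0 = 0`. -/
def quasiDeriv (L : DiffExpr H) (r : ℕ) (J : Set ℝ) (y : ℝ → H) : ℕ → ℝ → H
  | 0 => fun t => if 0 < r / 2 then y t else mid t
  | k + 1 => fun t =>
      if k + 1 < r / 2 then iteratedDerivWithin (k + 1) y J t
      else if k + 1 = r / 2 then mid t
      else
        -derivWithin (quasiDeriv L r J y k) J t
          + L.p (r - (k + 1)) t (iteratedDerivWithin (r - (k + 1)) y J t)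
          + (Complex.I / 2) •
            (L.s (r - (k + 1) + 1) t (iteratedDerivWithin (r - (k + 1) + 1) y J t)
              - qterm (r - (k + 1)) t)
where
  /-- `q_j y^{(j-1)}`, with `q_0 = 0`. -/
  qterm (j : ℕ) (t : ℝ) : H :=
    if j = 0 then 0 else L.q j t (iteratedDerivWithin (j - 1) y J t)
  /-- `y^{[n]}`, `n = [r/2]`. -/
  mid (t : ℝ) : H :=
    if Even r then
      L.p (r / 2) t (iteratedDerivWithin (r / 2) y J t) - (Complex.I / 2) • qterm (r / 2) t
    else
      -((Complex.I / 2) • L.q (r / 2 + 1) t (iteratedDerivWithin (r / 2) y J t))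

/-- The vector `\vec y(t, L, m, f) ∈ H^r`; `L` has order `r`, `m` has even order `s`, and
`f^{[k]}(t|m)` is read as `0` for `k < s/2`. With `n = [r/2]` its components are
`y^{(0)}, …, y^{(n-1)}`, then `y^{[r-j]}(t|L) - f^{[s-j]}(t|m)` for `j = 1, …, n`, then
(if `r = 2n+1 > 1`) `-i y^{(n)}`; for `r = 1` it is `y(t)`. -/
def vec (L m : DiffExpr H) (r s : ℕ) (J : Set ℝ) (y f : ℝ → H) (t : ℝ) : HilbPow H r :=
  WithLp.toLp 2 fun k : Fin r =>
    if r = 1 then y t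
    else if (k : ℕ) < r / 2 then iteratedDerivWithin k y J t
    else if (k : ℕ) < 2 * (r / 2) then
      L.quasiDeriv r J y (r - ((k : ℕ) - r / 2 + 1)) t
        - (if (k : ℕ) - r / 2 + 1 ≤ s / 2 then m.quasiDeriv s J f (s - ((k : ℕ) - r / 2 + 1)) t else 0)
    else -(Complex.I • iteratedDerivWithin (r / 2) y J t)

/-- The sesquilinear form
`∑ (p_j h_j, g_j) + (i/2) ∑ {(s_j h_j, g_{j-1}) - (q_j h_{j-1}, g_j)}` of the expression `L` of
order `r` at the point `t`; here `(x, y)` is linear in `x`, that is `(x, y) = inner ℂ y x`. -/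
def vecForm (L : DiffExpr H) (r : ℕ) (t : ℝ) (h g : ℕ → H) : ℂ :=
  ∑ j ∈ Finset.range (r / 2 + 1), inner ℂ (g j) (L.p j t (h j))
    + (Complex.I / 2) * ∑ j ∈ Finset.Icc 1 ((r + 1) / 2),
      (inner ℂ (g (j - 1)) (L.s j t (h j)) - inner ℂ (g j) (L.q j t (h (j - 1))))

/-- The form `L{f, g}(t)` under the Dirichlet integral. -/
def form (L : DiffExpr H) (r : ℕ) (J : Set ℝ) (f g : ℝ → H) (t : ℝ) : ℂ :=
  L.vecForm r t (fun j => iteratedDerivWithin j f J t) (fun j => iteratedDerivWithin j g J t)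

/-- The coefficients are as smooth on `J` as required: `p_j, q_j, s_j ∈ C^j`. -/
def SmoothOn (L : DiffExpr H) (r : ℕ) (J : Set ℝ) : Prop :=
  (∀ j, 2 * j ≤ r → ContDiffOn ℝ j (L.p j) J) ∧
  (∀ j, 1 ≤ j → 2 * j ≤ r + 1 → ContDiffOn ℝ j (L.q j) J ∧ ContDiffOn ℝ j (L.s j) J)

/-- The order of `L` is at most `s` on `J`: the coefficients beyond order `s` vanish. -/
def OrderLE (L : DiffExpr H) (s : ℕ) (J : Set ℝ) : Prop :=
  ∀ t ∈ J, (∀ j, s < 2 * j → L.p j t = 0) ∧ (∀ j, s + 1 < 2 * j → L.q j t = 0 ∧ L.s j t = 0)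

/-- The leading coefficient of the expression `L` of order `r` has an inverse in `B(H)` at `t`:
`p_n` if `r = 2n`, `q_{n+1} + s_{n+1}` if `r = 2n+1`. -/
def LeadingInvertible (L : DiffExpr H) (r : ℕ) (t : ℝ) : Prop :=
  if Even r then IsUnit (L.p (r / 2) t) else IsUnit (L.q (r / 2 + 1) t + L.s (r / 2 + 1) t)

/-- The coefficient-wise derivative `∂L_z/∂z`. -/
def paramDeriv (L : ℂ → DiffExpr H) (z : ℂ) : DiffExpr H where
  p j t := deriv (fun w => (L w).p j t) z
  q j t := deriv (fun w => (L w).q j t) z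
  s j t := deriv (fun w => (L w).s j t) z

/-- The operator matrix `Q(t, L)` in `B(H^r)`: with `n = [r/2]`, the block matrix with rows
`(0, i I_n)`, `(-i I_n, 0)`, and, if `r = 2n+1`, the additional diagonal entry `q_{n+1}(t)`. -/
def Q (L : DiffExpr H) (r : ℕ) (t : ℝ) : HilbPow H r →L[ℂ] HilbPow H r :=
  (PiLp.continuousLinearEquiv 2 ℂ (fun _ : Fin r => H)).symm.toContinuousLinearMap.comp
    (ContinuousLinearMap.pi fun k : Fin r =>
      if h : (k : ℕ) < r / 2 then
        Complex.I • PiLp.proj 2 (fun _ : Fin r => H) ⟨k + r / 2, by omega⟩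
      else if (k : ℕ) < 2 * (r / 2) then
        (-Complex.I) • PiLp.proj 2 (fun _ : Fin r => H) ⟨k - r / 2, by omega⟩
      else (L.q (r / 2 + 1) t).comp (PiLp.proj 2 (fun _ : Fin r => H) k))

variable [CompleteSpace H]

/-- The formally adjoint expression: coefficients `p_j^*`, `s_j^*`, `q_j^*`. -/
def adj (L : DiffExpr H) : DiffExpr H where
  p j t := ContinuousLinearMap.adjoint (L.p j t)
  q j t := ContinuousLinearMap.adjoint (L.s j t)
  s j t := ContinuousLinearMap.adjoint (L.q j t)

/-- `Re L = (L + L^*) / 2`. -/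
def re (L : DiffExpr H) : DiffExpr H where
  p j t := (1 / 2 : ℂ) • (L.p j t + L.adj.p j t)
  q j t := (1 / 2 : ℂ) • (L.q j t + L.adj.q j t)
  s j t := (1 / 2 : ℂ) • (L.s j t + L.adj.s j t)

/-- `L_1 = L_2` as expressions of order `r` on `J`. -/
def EqOn (L₁ L₂ : DiffExpr H) (r : ℕ) (J : Set ℝ) : Prop :=
  ∀ t ∈ J, (∀ j, 2 * j ≤ r → L₁.p j t = L₂.p j t) ∧
    (∀ j, 1 ≤ j → 2 * j ≤ r + 1 → L₁.q j t = L₂.q j t ∧ L₁.s j t = L₂.s j t)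

/-- The expression `Im L_z / Im z`, with `Im L = (L - L^*) / (2i)`; for real `z` it is understood as
`∂L_z/∂z`. -/
def imQuot (L : ℂ → DiffExpr H) (z : ℂ) : DiffExpr H :=
  if z.im = 0 then paramDeriv L z
  else
    { p := fun j t => (1 / (2 * Complex.I * z.im) : ℂ) • ((L z).p j t - (L z).adj.p j t)
      q := fun j t => (1 / (2 * Complex.I * z.im) : ℂ) • ((L z).q j t - (L z).adj.q j t)
      s := fun j t => (1 / (2 * Complex.I * z.im) : ℂ) • ((L z).s j t - (L z).adj.s j t) }

/-- The operator `Re Q(t, L) = (Q + Q^*) / 2`. -/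
def reQ (L : DiffExpr H) (r : ℕ) (t : ℝ) : HilbPow H r →L[ℂ] HilbPow H r :=
  (1 / 2 : ℂ) • (L.Q r t + ContinuousLinearMap.adjoint (L.Q r t))

/-- The family `L_z` of expressions of order `r` on `[a, b]` is such that `-L_z` depends on `z` in
the Nevanlinna manner, with the set `B ⊇ ℂ \ ℝ` of admissible values of the parameter. -/
structure IsNevanlinnaOn (L : ℂ → DiffExpr H) (r : ℕ) (a b : ℝ) (B : Set ℂ) : Prop where
  nonreal_subset : {z : ℂ | z.im ≠ 0} ⊆ B
  analytic : ∀ z ∈ B, ∃ U ∈ 𝓝 z, ∀ t ∈ Icc a b,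
    (∀ j, 2 * j ≤ r → DifferentiableOn ℂ (fun w => (L w).p j t) U) ∧
    (∀ j, 1 ≤ j → 2 * j ≤ r + 1 → DifferentiableOn ℂ (fun w => (L w).q j t) U ∧
      DifferentiableOn ℂ (fun w => (L w).s j t) U)
  smooth : ∀ z ∈ B, (L z).SmoothOn r (Icc a b)
  leading : ∀ z ∈ B, ∀ t ∈ Icc a b, (L z).LeadingInvertible r t
  symm : ∀ z ∈ B, (L z).EqOn (L (conj z)).adj r (Icc a b)
  dissipative : ∀ z : ℂ, z.im ≠ 0 → ∀ t ∈ Icc a b, ∀ h : ℕ → H,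
    ((L z).vecForm r t h h).im / z.im ≤ 0

/-- `m` is a symmetric expression of even order `s ≤ r` with smooth coefficients on `[a, b]` and
`0 ≤ m{·,·} ≤ -Im L_z{·,·} / Im z` for nonreal `z`. -/
structure IsWeightFor (m : DiffExpr H) (s : ℕ) (L : ℂ → DiffExpr H) (r : ℕ) (a b : ℝ) : Prop where
  even : Even s
  le : s ≤ r
  order : m.OrderLE s (Icc a b)
  smooth : m.SmoothOn s (Icc a b)
  symm : m.EqOn m.adj s (Icc a b)
  nonneg : ∀ t ∈ Icc a b, ∀ h : ℕ → H, 0 ≤ (m.vecForm s t h h).re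
  le_im : ∀ z : ℂ, z.im ≠ 0 → ∀ t ∈ Icc a b, ∀ h : ℕ → H,
    (m.vecForm s t h h).re ≤ -((L z).vecForm r t h h).im / z.im

/-- The definiteness condition with `P = I_r` for the equation with the family `L_z` on `[a, b]`:
for some `z₀ ∈ B`, `[α, β] ∋ 0` and `δ > 0`,
`-∫_α^β (Im L_{z₀} / Im z₀){y, y} dt ≥ δ ‖\vec y(0, L_{z₀}, m, 0)‖²`
for every solution `y` of `L_{z₀}[y] = 0` on `[a, b]`. -/
def IsDefinite (L : ℂ → DiffExpr H) (m : DiffExpr H) (r s : ℕ) (a b : ℝ) (B : Set ℂ) : Prop :=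
  ∃ z₀ ∈ B, ∃ α ∈ Icc a b, ∃ β ∈ Icc a b, α ≤ 0 ∧ 0 ≤ β ∧ ∃ δ > (0 : ℝ),
    ∀ y : ℝ → H, ContDiffOn ℝ r y (Icc a b) →
      (∀ t ∈ Icc a b, (L z₀).apply r (Icc a b) y t = 0) →
      δ * ‖(L z₀).vec m r s (Icc a b) y 0 0‖ ^ 2
        ≤ -∫ t in α..β, ((imQuot L z₀).form r (Icc a b) y y t).re

/-- The subspace `S` of `E ⊕ E` is nonnegative for the form of `c · diag(A₁, -A₂)`. -/
def IsNonnegSubspace {E : Type*} [NormedAddCommGroup E] [InnerProductSpace ℂ E]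
    (c : ℝ) (A₁ A₂ : E →L[ℂ] E) (S : Submodule ℂ (E × E)) : Prop :=
  ∀ x ∈ S, 0 ≤ c * ((inner ℂ x.1 (A₁ x.1)).re - (inner ℂ x.2 (A₂ x.2)).re)

/-- The operator functions `𝓜_z, 𝓝_z ∈ B(H^r)` define dissipative boundary conditions
`\vec y(a) = 𝓜_z h`, `\vec y(b) = 𝓝_z h` for the equation with the family `L_z`. -/
structure IsBoundaryPair (L : ℂ → DiffExpr H) (r : ℕ) (a b : ℝ)
    (𝓜 𝓝' : ℂ → (HilbPow H r →L[ℂ] HilbPow H r)) : Prop where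
  analytic_left : DifferentiableOn ℂ 𝓜 {z | z.im ≠ 0}
  analytic_right : DifferentiableOn ℂ 𝓝' {z | z.im ≠ 0}
  lagrangian : ∀ z : ℂ, z.im ≠ 0 →
    (ContinuousLinearMap.adjoint (𝓜 (conj z))).comp (((L z).reQ r a).comp (𝓜 z)) =
      (ContinuousLinearMap.adjoint (𝓝' (conj z))).comp (((L z).reQ r b).comp (𝓝' z))
  injective : ∀ z : ℂ, z.im ≠ 0 → ∀ h : HilbPow H r, h ≠ 0 → 0 < ‖𝓜 z h‖ + ‖𝓝' z h‖
  maximal : ∀ z : ℂ, z.im ≠ 0 →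
    Maximal (IsNonnegSubspace z.im ((L z).reQ r a) ((L z).reQ r b))
      (LinearMap.range ((𝓜 z).prod (𝓝' z)).toLinearMap)

/-- `y ∈ C^r([a, b], H)` solves the boundary problem `L_z[y] = m[f]`,
`\vec y(a, L_z, m, f) = 𝓜_z h`, `\vec y(b, L_z, m, f) = 𝓝_z h` for some `h ∈ H^r`. -/
def SolvesBoundaryProblem (L : ℂ → DiffExpr H) (m : DiffExpr H) (r s : ℕ) (a b : ℝ)
    (𝓜 𝓝' : ℂ → (HilbPow H r →L[ℂ] HilbPow H r)) (z : ℂ) (f y : ℝ → H) : Prop :=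
  ContDiffOn ℝ r y (Icc a b) ∧
  (∀ t ∈ Icc a b, (L z).apply r (Icc a b) y t = m.apply s (Icc a b) f t) ∧
  ∃ h : HilbPow H r, (L z).vec m r s (Icc a b) y f a = 𝓜 z h ∧
    (L z).vec m r s (Icc a b) y f b = 𝓝' z h

/-- The limit of `(Re Q(t) v(t), v(t)) / Im z |_α^β` as `α ↓ a`, `β ↑ b` exists and is `≤ 0`. -/
def BoundaryFormLimitNonpos {E : Type*} [NormedAddCommGroup E] [InnerProductSpace ℂ E]
    (A : ℝ → (E →L[ℂ] E)) (v : ℝ → E) (a b : ℝ) (z : ℂ) : Prop :=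
  ∃ c : ℝ, c ≤ 0 ∧
    Tendsto (fun x : ℝ × ℝ =>
        ((inner ℂ (v x.2) (A x.2 (v x.2))).re - (inner ℂ (v x.1) (A x.1 (v x.1))).re) / z.im)
      (𝓝[>] a ×ˢ 𝓝[<] b) (𝓝 c)

end DiffExpr

end

/-!
The definiteness condition is stable because the perturbation is controlled by the very form whose
integral it concerns. At `z = i` the perturbed expression is `L = l - i K` with `K = -Im L ≥ m ≥ 0`,
so that it differs from `L₁ = l - z₀ m` by a combination of the nonnegative forms `K` and `m`. By
the Cauchy–Schwarz inequality the entries of this difference, applied to a function `y`, are bounded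
by the square root of `K{y, y}` (`norm_row_sq_le`). In odd order a nonnegative form has no term of
the highest order (`row_top_eq_zero`), so that the leading coefficients of `L` and `L₁` agree then.

The derivatives of `y` in the lower half and the quasi-derivatives in the upper half form the phase
vector of `y`. For solutions of `L₁[y] = 0` it satisfies a linear first order system with continuous
coefficients, which is solvable on the whole interval for every initial value, and the solutions
come from `C^r` functions (`exists_solution_phase_eq`). Quasi-derivatives are made so that the phase
vector of a solution of `L[y] = 0` satisfies the system of `L₁` up to an error which involves the
entries of `L - L₁` but none of their derivatives (`exists_norm_phase_deriv_sub_le`). Hence, if `y`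
solves `L[y] = 0` and `y₁` solves `L₁[y₁] = 0` with the same phase vector at `0`, the energy
estimate `norm_sq_le_of_norm_deriv_sq_le` bounds the difference of the phase vectors, and with it
`∫ m{y₁, y₁}`, by a multiple of `∫ K{y, y}`. The condition for `L₁`, applied to `y₁`, is then the one
for `L` (`exists_norm_phase_sq_le_integral`).

In the second part the difference of the boundary vectors at `a` and `b` lies in the range of
`(𝓜_z, 𝓝_z)`, a nonnegative subspace, and the boundary vectors are continuous up to the end points, so that
the limit is the difference of the boundary values.
-/

/-! ### Linear differential equations on a compact interval -/

section LinearODE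

/-- Gronwall's inequality with a continuous inhomogeneity `κ ≥ 0`, forward in time. -/
lemma le_exp_mul_add_integral_of_deriv_le {φ φ' κ : ℝ → ℝ} {t₀ t₁ C : ℝ} (h01 : t₀ ≤ t₁)
    (hC : 0 ≤ C)
    (hφ : ∀ t ∈ Icc t₀ t₁, HasDerivWithinAt φ (φ' t) (Icc t₀ t₁) t)
    (hκ : Continuous κ) (hκ0 : ∀ t, 0 ≤ κ t)
    (hle : ∀ t ∈ Icc t₀ t₁, φ' t ≤ C * φ t + κ t) :
    φ t₁ ≤ Real.exp (C * (t₁ - t₀)) * (φ t₀ + ∫ t in t₀..t₁, κ t) := by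
  -- `exp (-C (t - t₀)) φ t - ∫ κ` is nonincreasing
  set ψ : ℝ → ℝ := fun t => Real.exp (-(C * (t - t₀))) * φ t - ∫ u in t₀..t, κ u with hψ
  have hder : ∀ t ∈ Icc t₀ t₁, HasDerivWithinAt ψ
      (Real.exp (-(C * (t - t₀))) * (-(C * 1)) * φ t + Real.exp (-(C * (t - t₀))) * φ' t - κ t)
      (Icc t₀ t₁) t := by
    intro t ht
    have h1 : HasDerivAt (fun t => Real.exp (-(C * (t - t₀))))
        (Real.exp (-(C * (t - t₀))) * (-(C * 1))) t :=
      ((((hasDerivAt_id t).sub_const t₀).const_mul C).neg).exp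
    exact (h1.hasDerivWithinAt.mul (hφ t ht)).sub
      (hκ.integral_hasStrictDerivAt t₀ t).hasDerivAt.hasDerivWithinAt
  have hanti : AntitoneOn ψ (Icc t₀ t₁) := by
    refine antitoneOn_of_deriv_nonpos (convex_Icc _ _)
      (fun t ht => (hder t ht).continuousWithinAt) ?_ ?_
    · intro t ht
      exact ((hder t (interior_subset ht)).mono interior_subset).differentiableWithinAt
    · intro t ht
      have ht' := interior_subset ht
      rw [((hder t ht').hasDerivAt (mem_interior_iff_mem_nhds.1 ht)).deriv]
      have he : Real.exp (-(C * (t - t₀))) ≤ 1 := by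
        rw [Real.exp_le_one_iff]
        have := mul_nonneg hC (sub_nonneg.2 ht'.1)
        linarith
      have hp := Real.exp_pos (-(C * (t - t₀)))
      have h1 := mul_le_mul_of_nonneg_left (hle t ht') hp.le
      have h2 := mul_le_mul_of_nonneg_right he (hκ0 t)
      nlinarith
  have h := hanti (left_mem_Icc.2 h01) (right_mem_Icc.2 h01) h01
  simp only [hψ, sub_self, mul_zero, neg_zero, Real.exp_zero, one_mul,
    intervalIntegral.integral_same, sub_zero] at h
  have h3 : φ t₁ = Real.exp (C * (t₁ - t₀)) * (Real.exp (-(C * (t₁ - t₀))) * φ t₁) := by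
    rw [← mul_assoc, ← Real.exp_add]; simp
  rw [h3]
  exact mul_le_mul_of_nonneg_left (by linarith) (Real.exp_pos _).le

variable {F : Type*} [NormedAddCommGroup F] [InnerProductSpace ℂ F]

/-- The two-sided energy estimate: if `‖d'‖² ≤ C ‖d‖² + κ` on `[a, b]`, then `‖d‖²` at any point of
`[α, β] ∋ 0` is bounded by its value at `0` and the integral of `κ`. -/
lemma norm_sq_le_of_norm_deriv_sq_le {d d' : ℝ → F} {κ : ℝ → ℝ} {a b α β C : ℝ} (hC : 0 ≤ C)
    (hα : α ∈ Icc a b) (hβ : β ∈ Icc a b) (hα0 : α ≤ 0) (hβ0 : 0 ≤ β)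
    (hd : ∀ t ∈ Icc a b, HasDerivWithinAt d (d' t) (Icc a b) t)
    (hκ : ContinuousOn κ (Icc a b)) (hκ0 : ∀ t ∈ Icc a b, 0 ≤ κ t)
    (hle : ∀ t ∈ Icc a b, ‖d' t‖ ^ 2 ≤ C * ‖d t‖ ^ 2 + κ t) :
    ∀ t ∈ Icc α β, ‖d t‖ ^ 2 ≤
      Real.exp ((C + 1) * (b - a)) * (‖d 0‖ ^ 2 + ∫ u in α..β, κ u) := by
  have hab : a ≤ b := hα.1.trans hα.2
  set k : ℝ → ℝ := IccExtend hab ((Icc a b).domRestrict κ) with hk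
  have hkc : Continuous k := (continuousOn_iff_continuous_domRestrict.1 hκ).Icc_extend'
  have hk0 : ∀ t, 0 ≤ k t := fun t => hκ0 _ (projIcc a b hab t).2
  have hkκ : ∀ t ∈ Icc a b, k t = κ t := fun t ht => by
    simp [hk, IccExtend_of_mem hab _ ht, domRestrict]
  have hint : ∀ t₀ t₁ : ℝ, t₀ ∈ Icc α β → t₁ ∈ Icc α β → t₀ ≤ t₁ →
      ∫ u in t₀..t₁, k u ≤ ∫ u in α..β, κ u := by
    intro t₀ t₁ h0 h1 h01
    calc ∫ u in t₀..t₁, k u ≤ ∫ u in α..β, k u :=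
          intervalIntegral.integral_mono_interval h0.1 h01 h1.2
            (Eventually.of_forall hk0) (hkc.intervalIntegrable _ _)
      _ = ∫ u in α..β, κ u := by
          refine intervalIntegral.integral_congr fun u hu => hkκ u ?_
          rw [uIcc_of_le (hα0.trans hβ0)] at hu
          exact ⟨hα.1.trans hu.1, hu.2.trans hβ.2⟩
  have hsq : ∀ t, ‖d t‖ ^ 2 = (inner ℂ (d t) (d t)).re := fun t =>
    (inner_self_eq_norm_sq (𝕜 := ℂ) (d t)).symm
  have hφ : ∀ t ∈ Icc a b, HasDerivWithinAt (fun t => ‖d t‖ ^ 2) (2 * (inner ℂ (d t) (d' t)).re)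
      (Icc a b) t := by
    intro t ht
    have h1 := Complex.reCLM.hasFDerivAt.comp_hasDerivWithinAt t ((hd t ht).inner ℂ (hd t ht))
    have h2 : (inner ℂ (d' t) (d t)).re = (inner ℂ (d t) (d' t)).re := by
      rw [← inner_conj_symm, Complex.conj_re]
    refine (h1.congr_deriv ?_).congr (fun u _ => ?_) ?_
    · simp [h2]; ring
    · simpa using hsq u
    · simpa using hsq t
  have habs : ∀ t ∈ Icc a b, |2 * (inner ℂ (d t) (d' t)).re| ≤ (C + 1) * ‖d t‖ ^ 2 + k t := by
    intro t ht
    rw [hkκ t ht]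
    have h1 : |(inner ℂ (d t) (d' t)).re| ≤ ‖d t‖ * ‖d' t‖ :=
      (Complex.abs_re_le_norm _).trans (norm_inner_le_norm _ _)
    rw [abs_mul, abs_two]
    nlinarith [hle t ht, sq_nonneg (‖d t‖ - ‖d' t‖)]
  have hexp : ∀ u, 0 ≤ u → u ≤ b - a →
      Real.exp ((C + 1) * u) ≤ Real.exp ((C + 1) * (b - a)) := fun u _ hu =>
    Real.exp_le_exp.2 (mul_le_mul_of_nonneg_left hu (by linarith))
  intro t ht
  have hαβ := hα0.trans hβ0
  have h0m : (0 : ℝ) ∈ Icc α β := ⟨hα0, hβ0⟩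
  have htab : t ∈ Icc a b := ⟨hα.1.trans ht.1, ht.2.trans hβ.2⟩
  rcases le_total 0 t with h0t | ht0
  · have hsub : Icc 0 t ⊆ Icc a b := Icc_subset_Icc (hα.1.trans hα0) htab.2
    have h := le_exp_mul_add_integral_of_deriv_le (φ := fun t => ‖d t‖ ^ 2) (κ := k)
      (C := C + 1) h0t (by linarith)
      (fun u hu => (hφ u (hsub hu)).mono hsub) hkc hk0
      (fun u hu => (le_abs_self _).trans (habs u (hsub hu)))
    have hi := hint 0 t h0m ht h0t
    have hi0 : 0 ≤ ∫ u in (0 : ℝ)..t, k u := intervalIntegral.integral_nonneg h0t fun u _ => hk0 u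
    refine h.trans (mul_le_mul (hexp _ (by linarith) ?_) (by linarith) (by positivity)
      (Real.exp_pos _).le)
    linarith [htab.2, hα.1]
  · have hsub : ∀ u ∈ Icc 0 (-t), -u ∈ Icc a b := fun u hu =>
      ⟨by linarith [htab.1, hu.2], by linarith [hβ.2, hu.1]⟩
    have h := le_exp_mul_add_integral_of_deriv_le (φ := fun u => ‖d (-u)‖ ^ 2)
      (φ' := fun u => 2 * (inner ℂ (d (-u)) (d' (-u))).re * (-1))
      (κ := fun u => k (-u)) (C := C + 1) (t₀ := 0) (t₁ := -t) (by linarith) (by linarith)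
      (fun u hu => (hφ (-u) (hsub u hu)).comp u (hasDerivAt_neg u).hasDerivWithinAt hsub)
      (hkc.comp continuous_neg) (fun u => hk0 _)
      (fun u hu => by
        have := (neg_abs_le _).trans' (neg_le_neg (habs _ (hsub u hu)))
        linarith)
    have hi := hint t 0 ht h0m ht0
    have hi0 : 0 ≤ ∫ u in t..(0 : ℝ), k u := intervalIntegral.integral_nonneg ht0 fun u _ => hk0 u
    rw [intervalIntegral.integral_comp_neg (fun u => k u)] at h
    simp only [neg_neg, neg_zero] at h
    refine h.trans (mul_le_mul (hexp _ (by linarith) ?_) (by linarith) (by positivity)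
      (Real.exp_pos _).le)
    linarith [htab.1, hβ.2]

/-- The radial retraction onto the ball of radius `R` is Lipschitz with constant `2`. -/
lemma norm_radialRetraction_sub_le {F : Type*} [NormedAddCommGroup F] [NormedSpace ℝ F] {R : ℝ}
    (hR : 0 < R) (x y : F) :
    ‖(R / max R ‖x‖) • x - (R / max R ‖y‖) • y‖ ≤ 2 * ‖x - y‖ := by
  set M := max R ‖x‖
  set N := max R ‖y‖
  have hM : 0 < M := lt_max_of_lt_left hR
  have hN : 0 < N := lt_max_of_lt_left hR
  have hRM : R / M ≤ 1 := (div_le_one hM).2 (le_max_left _ _)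
  have hyN : ‖y‖ / N ≤ 1 := (div_le_one hN).2 (le_max_right _ _)
  have hMN : |N - M| ≤ ‖x - y‖ := by
    refine (abs_max_sub_max_le_max R ‖y‖ R ‖x‖).trans ?_
    simp only [sub_self, abs_zero]
    refine max_le (norm_nonneg _) ?_
    rw [norm_sub_rev]; exact abs_norm_sub_norm_le _ _
  have e : (R / M) • x - (R / N) • y = (R / M) • (x - y) + (R / M - R / N) • y := by
    rw [smul_sub, sub_smul]; abel
  have e2 : |R / M - R / N| * ‖y‖ = (R / M) * (|N - M| * (‖y‖ / N)) := by
    have : R / M - R / N = (R / M) * ((N - M) / N) := by field_simp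
    rw [this, abs_mul, abs_of_pos (div_pos hR hM), abs_div, abs_of_pos hN]
    ring
  rw [e]
  refine (norm_add_le _ _).trans ?_
  rw [norm_smul, norm_smul, Real.norm_eq_abs, Real.norm_eq_abs, e2, abs_of_pos (div_pos hR hM)]
  have hRM0 : 0 ≤ R / M := by positivity
  have h1 : R / M * ‖x - y‖ ≤ ‖x - y‖ := mul_le_of_le_one_left (norm_nonneg _) hRM
  have h2 : |N - M| * (‖y‖ / N) ≤ ‖x - y‖ :=
    (mul_le_of_le_one_right (abs_nonneg _) hyN).trans hMN
  have h3 : R / M * (|N - M| * (‖y‖ / N)) ≤ ‖x - y‖ :=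
    (mul_le_of_le_one_left (by positivity) hRM).trans h2
  linarith

/-- Global existence for linear equations `x' = A(t) x` with continuous bounded operators `A(t)`.
The right-hand side is truncated outside a large ball, where Picard–Lindelöf applies on the whole
interval; by the energy estimate the solution never leaves that ball. -/
lemma exists_solution_linearODE [CompleteSpace F] {a b : ℝ} (h0 : (0 : ℝ) ∈ Icc a b)
    {A : ℝ → F →L[ℂ] F} (hA : ContinuousOn A (Icc a b)) (x₀ : F) :
    ∃ x : ℝ → F, x 0 = x₀ ∧ ∀ t ∈ Icc a b, HasDerivWithinAt x (A t (x t)) (Icc a b) t := by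
  obtain ⟨K₀, hK₀⟩ := isCompact_Icc.exists_bound_of_continuousOn hA
  obtain ⟨K, hK⟩ : ∃ K : NNReal, ∀ t ∈ Icc a b, ‖A t‖ ≤ K :=
    ⟨K₀.toNNReal, fun t ht => (hK₀ t ht).trans (Real.le_coe_toNNReal _)⟩
  have hab : a ≤ b := h0.1.trans h0.2
  obtain ⟨R, hR0, hR⟩ : ∃ R : ℝ, 0 < R ∧
      Real.exp ((K ^ 2 + 1) * (b - a)) * ‖x₀‖ ^ 2 ≤ R ^ 2 := by
    refine ⟨Real.exp ((K ^ 2 + 1) * (b - a)) * ‖x₀‖ ^ 2 + 1, by positivity, ?_⟩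
    have : 0 ≤ Real.exp ((K ^ 2 + 1) * (b - a)) * ‖x₀‖ ^ 2 := by positivity
    nlinarith
  set ρ : F → F := fun x => (R / max R ‖x‖) • x with hρ
  have hρR : ∀ x, ‖ρ x‖ ≤ R := fun x => by
    have hM : 0 < max R ‖x‖ := lt_max_of_lt_left hR0
    rw [hρ, norm_smul, Real.norm_eq_abs, abs_of_pos (div_pos hR0 hM), div_mul_eq_mul_div,
      div_le_iff₀ hM]
    exact mul_le_mul_of_nonneg_left (le_max_right _ _) hR0.le
  have hρx : ∀ x, ‖ρ x‖ ≤ ‖x‖ := fun x => by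
    have hM : 0 < max R ‖x‖ := lt_max_of_lt_left hR0
    rw [hρ, norm_smul, Real.norm_eq_abs, abs_of_pos (div_pos hR0 hM)]
    exact mul_le_of_le_one_left (norm_nonneg _) ((div_le_one hM).2 (le_max_left _ _))
  have hρid : ∀ x, ‖x‖ ≤ R → ρ x = x := fun x hx => by
    simp [hρ, max_eq_left hx, hR0.ne']
  set L : NNReal := K * R.toNNReal
  have hPL : IsPicardLindelof (fun t x => A t (ρ x)) (⟨0, h0⟩ : Icc a b) x₀
      (L * (max (b - 0) (0 - a)).toNNReal) 0 L (K * 2) := by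
    refine ⟨fun t ht => ?_, fun x _ => ?_, fun t ht x _ => ?_, ?_⟩
    · refine LipschitzWith.lipschitzOnWith (LipschitzWith.of_dist_le_mul fun x y => ?_)
      rw [dist_eq_norm, dist_eq_norm, ← map_sub]
      refine ((A t).le_opNorm _).trans ?_
      push_cast
      rw [mul_assoc]
      exact mul_le_mul (hK t ht) (norm_radialRetraction_sub_le hR0 x y) (norm_nonneg _) K.2
    · exact hA.clm_apply continuousOn_const
    · refine ((A t).le_opNorm _).trans ?_
      simp only [L, NNReal.coe_mul, Real.coe_toNNReal R hR0.le]
      exact mul_le_mul (hK t ht) (hρR x) (norm_nonneg _) K.2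
    · simp only [NNReal.coe_mul, NNReal.coe_zero, sub_zero]
      exact mul_le_mul_of_nonneg_left (Real.le_coe_toNNReal _) (by positivity)
  obtain ⟨x, hx0, hx⟩ := hPL.exists_eq_forall_mem_Icc_hasDerivWithinAt₀
  have hx0 : x 0 = x₀ := hx0
  have hbd := norm_sq_le_of_norm_deriv_sq_le (κ := fun _ => 0) (C := K ^ 2) (by positivity)
    (left_mem_Icc.2 hab) (right_mem_Icc.2 hab) h0.1 h0.2 hx continuousOn_const (fun _ _ => le_rfl)
    (fun t ht => by
      rw [add_zero, ← mul_pow]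
      exact pow_le_pow_left₀ (norm_nonneg _)
        (((A t).le_opNorm _).trans (mul_le_mul (hK t ht) (hρx _) (norm_nonneg _) K.2)) 2)
  refine ⟨x, hx0, fun t ht => ?_⟩
  have h1 := hbd t ht
  rw [hx0] at h1
  simp only [intervalIntegral.integral_zero, add_zero] at h1
  have h2 : ‖x t‖ ≤ R := (pow_le_pow_iff_left₀ (norm_nonneg _) hR0.le two_ne_zero).1 (h1.trans hR)
  have h3 := hx t ht
  rwa [hρid _ h2] at h3

end LinearODE

/-! ### Calculus of operator-valued coefficients -/

section Calculus

variable {H : Type*} [NormedAddCommGroup H] [InnerProductSpace ℂ H]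

lemma ContDiffOn.clm_apply_complex {n : WithTop ℕ∞} {J : Set ℝ} {A : ℝ → H →L[ℂ] H} {x : ℝ → H}
    (hA : ContDiffOn ℝ n A J) (hx : ContDiffOn ℝ n x J) :
    ContDiffOn ℝ n (fun t => A t (x t)) J := by
  have hA' : ContDiffOn ℝ n (fun t => ContinuousLinearMap.restrictScalarsL ℂ H H ℝ ℝ (A t)) J :=
    (ContinuousLinearMap.contDiff _).comp_contDiffOn hA
  exact hA'.clm_apply hx

lemma HasDerivWithinAt.clm_apply_complex {t : ℝ} {J : Set ℝ} {A : ℝ → H →L[ℂ] H} {x : ℝ → H}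
    {A' : H →L[ℂ] H} {x' : H} (hA : HasDerivWithinAt A A' J t) (hx : HasDerivWithinAt x x' J t) :
    HasDerivWithinAt (fun t => A t (x t)) (A' (x t) + A t x') J t := by
  have hA' : HasDerivWithinAt (fun t => ContinuousLinearMap.restrictScalarsL ℂ H H ℝ ℝ (A t))
      (ContinuousLinearMap.restrictScalarsL ℂ H H ℝ ℝ A') J t :=
    (ContinuousLinearMap.hasFDerivAt _).comp_hasDerivWithinAt _ hA
  exact hA'.clm_apply hx

lemma ContDiffOn.ringInverse [CompleteSpace H] {n : WithTop ℕ∞} {J : Set ℝ} {A : ℝ → H →L[ℂ] H}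
    (hA : ContDiffOn ℝ n A J) (hu : ∀ t ∈ J, IsUnit (A t)) :
    ContDiffOn ℝ n (fun t => Ring.inverse (A t)) J := by
  intro t ht
  obtain ⟨u, hu⟩ := hu t ht
  have := contDiffAt_ringInverse ℝ u (n := n)
  rw [hu] at this
  exact this.comp_contDiffWithinAt t (hA t ht)

variable {E : Type*} [NormedAddCommGroup E] [NormedSpace ℝ E] {J : Set ℝ}

lemma ContDiffOn.iteratedDerivWithin_of_add {m : ℕ} (hJ : UniqueDiffOn ℝ J) {y : ℝ → E} (k : ℕ)
    (hy : ContDiffOn ℝ (m + k : ℕ) y J) : ContDiffOn ℝ m (iteratedDerivWithin k y J) J := by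
  induction k generalizing m with
  | zero => simpa using hy
  | succ k ih =>
    rw [iteratedDerivWithin_succ]
    refine (ih (m := m + 1) (hy.of_le ?_)).derivWithin hJ (by norm_cast)
    norm_cast; omega

lemma contDiffOn_succ_of_hasDerivWithinAt (hJ : UniqueDiffOn ℝ J) {n : ℕ} {f f' : ℝ → E}
    (hf : ∀ t ∈ J, HasDerivWithinAt f (f' t) J t) (hf' : ContDiffOn ℝ n f' J) :
    ContDiffOn ℝ (n + 1 : ℕ) f J := by
  push_cast
  refine (contDiffOn_succ_iff_derivWithin hJ).2
    ⟨fun t ht => (hf t ht).differentiableWithinAt, fun h => absurd h (by simp), ?_⟩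
  exact hf'.congr fun t ht => (hf t ht).derivWithin (hJ t ht)

lemma ContDiffOn.hasDerivWithinAt_iteratedDerivWithin (hJ : UniqueDiffOn ℝ J) {n k : ℕ}
    {y : ℝ → E} (hy : ContDiffOn ℝ n y J) (hk : k < n) {t : ℝ} (ht : t ∈ J) :
    HasDerivWithinAt (iteratedDerivWithin k y J) (iteratedDerivWithin (k + 1) y J t) J t := by
  rw [iteratedDerivWithin_succ]
  exact (hy.differentiableOn_iteratedDerivWithin (by exact_mod_cast hk) hJ t ht).hasDerivWithinAt

end Calculus

/-! ### The rows of the form and the quasi-derivatives -/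

noncomputable section

namespace DiffExpr

variable {H : Type*} [NormedAddCommGroup H] [InnerProductSpace ℂ H]

/-- The `j`-th row `p_j h_j + (i/2) (s_{j+1} h_{j+1} - q_j h_{j-1})` of the form of `L`, so that
`L⟨h, g⟩ = ∑ (row_j h, g_j)`; coefficients that do not belong to an expression of order `r` are
read as `0`. -/
def row (L : DiffExpr H) (r : ℕ) (t : ℝ) (h : ℕ → H) (j : ℕ) : H :=
  (if 2 * j ≤ r then L.p j t (h j) else 0)
    + (Complex.I / 2) • ((if 2 * j + 1 ≤ r then L.s (j + 1) t (h (j + 1)) else 0)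
      - (if j ≠ 0 ∧ 2 * j ≤ r + 1 then L.q j t (h (j - 1)) else 0))

/-- The sequence of derivatives of `y` on `J` at the point `t`. -/
def jet (J : Set ℝ) (y : ℝ → H) (t : ℝ) (k : ℕ) : H := iteratedDerivWithin k y J t

lemma sum_rows_eq {M : Type*} [AddCommGroup M] [Module ℂ M] (r : ℕ) (c : ℂ) (P S Q : ℕ → M) :
    ∑ j ∈ Finset.range ((r + 1) / 2 + 1),
      ((if 2 * j ≤ r then P j else 0)
        + c • ((if 2 * j + 1 ≤ r then S (j + 1) else 0)
          - (if j ≠ 0 ∧ 2 * j ≤ r + 1 then Q j else 0)))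
    = ∑ j ∈ Finset.range (r / 2 + 1), P j
      + c • ∑ j ∈ Finset.Icc 1 ((r + 1) / 2), (S j - Q j) := by
  rw [Finset.sum_add_distrib, ← Finset.smul_sum, Finset.sum_sub_distrib, Finset.sum_sub_distrib]
  congr 1
  · rw [← Finset.sum_filter]
    refine Finset.sum_congr ?_ fun _ _ => rfl
    ext j; simp only [Finset.mem_filter, Finset.mem_range]; omega
  · congr 2
    · rw [← Finset.sum_filter]
      refine Finset.sum_bij (fun j _ => j + 1) ?_ ?_ ?_ ?_
      · intro j hj; simp only [Finset.mem_filter, Finset.mem_range, Finset.mem_Icc] at *; omega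
      · intro i _ j _ h; simpa using h
      · intro j hj
        simp only [Finset.mem_filter, Finset.mem_range, Finset.mem_Icc, exists_prop] at *
        exact ⟨j - 1, by omega, by omega⟩
      · intro _ _; rfl
    · rw [← Finset.sum_filter]
      refine Finset.sum_congr ?_ fun _ _ => rfl
      ext j; simp only [Finset.mem_filter, Finset.mem_range, Finset.mem_Icc]; omega

lemma vecForm_eq_sum_row (L : DiffExpr H) (r : ℕ) (t : ℝ) (h g : ℕ → H) :
    L.vecForm r t h g = ∑ j ∈ Finset.range ((r + 1) / 2 + 1), inner ℂ (g j) (L.row r t h j) := by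
  have := sum_rows_eq r (Complex.I / 2) (fun j => inner ℂ (g j) (L.p j t (h j)))
    (fun j => inner ℂ (g (j - 1)) (L.s j t (h j))) (fun j => inner ℂ (g j) (L.q j t (h (j - 1))))
  rw [vecForm, ← smul_eq_mul, ← this]
  refine Finset.sum_congr rfl fun j _ => ?_
  rw [row, inner_add_right, inner_smul_right, inner_sub_right]
  simp only [apply_ite (inner ℂ (g j)), inner_zero_right, smul_eq_mul, Nat.add_sub_cancel]

lemma row_congr {L L' : DiffExpr H} {r : ℕ} {J : Set ℝ} (h : L.EqOn L' r J) {t : ℝ} (ht : t ∈ J)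
    (x : ℕ → H) (j : ℕ) : L.row r t x j = L'.row r t x j := by
  obtain ⟨hp, hqs⟩ := h t ht
  unfold row
  congr 1
  · split_ifs with h1
    · rw [hp j h1]
    · rfl
  · congr 2
    · split_ifs with h1
      · rw [(hqs (j + 1) (by omega) (by omega)).2]
      · rfl
    · split_ifs with h1
      · rw [(hqs j (by omega) (by omega)).1]
      · rfl

/-- A row depends only on those entries `h_k`, `|k - j| ≤ 1`, for which `k + j ≤ r`. -/
lemma row_congr_right (L : DiffExpr H) {r j : ℕ} (t : ℝ) {x x' : ℕ → H}
    (h : ∀ k, j ≤ k + 1 → k ≤ j + 1 → k + j ≤ r → x k = x' k) :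
    L.row r t x j = L.row r t x' j := by
  unfold row
  congr 1
  · split_ifs with h1
    · rw [h j (by omega) (by omega) (by omega)]
    · rfl
  · congr 2
    · split_ifs with h1
      · rw [h (j + 1) (by omega) (by omega) (by omega)]
      · rfl
    · split_ifs with h1
      · rw [h (j - 1) (by omega) (by omega) (by omega)]
      · rfl

lemma row_sub (L : DiffExpr H) (r : ℕ) (t : ℝ) (x x' : ℕ → H) (j : ℕ) :
    L.row r t (fun k => x k - x' k) j = L.row r t x j - L.row r t x' j := by
  unfold row
  split_ifs <;> simp only [map_sub, smul_sub, sub_zero, smul_zero, add_zero] <;> module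

lemma row_contDiffOn {L : DiffExpr H} {r j e : ℕ} {J : Set ℝ} (hL : L.SmoothOn r J)
    (he : e ≤ j) {x : ℝ → ℕ → H}
    (hx : ∀ k, j ≤ k + 1 → k ≤ j + 1 → k + j ≤ r → ContDiffOn ℝ e (fun t => x t k) J) :
    ContDiffOn ℝ e (fun t => L.row r t (x t) j) J := by
  have hej : (e : WithTop ℕ∞) ≤ j := by exact_mod_cast he
  unfold row
  refine ContDiffOn.add ?_ (ContDiffOn.const_smul _ (ContDiffOn.sub ?_ ?_))
  · by_cases h : 2 * j ≤ r
    · simp only [h, if_true]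
      exact ((hL.1 j h).of_le hej).clm_apply_complex (hx j (by omega) (by omega) (by omega))
    · simp only [h, if_false]; exact contDiffOn_const
  · by_cases h : 2 * j + 1 ≤ r
    · simp only [h, if_true]
      refine (((hL.2 (j + 1) (by omega) (by omega)).2).of_le ?_).clm_apply_complex
        (hx (j + 1) (by omega) (by omega) (by omega))
      exact_mod_cast (show e ≤ j + 1 by omega)
    · simp only [h, if_false]; exact contDiffOn_const
  · by_cases h : j ≠ 0 ∧ 2 * j ≤ r + 1
    · simp only [if_pos h]
      exact (((hL.2 j (by omega) (by omega)).1).of_le hej).clm_apply_complex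
        (hx (j - 1) (by omega) (by omega) (by omega))
    · simp only [h, if_false]; exact contDiffOn_const

section Quasi

variable {L : DiffExpr H} {r : ℕ} {J : Set ℝ} {y : ℝ → H}

lemma jet_contDiffOn (hJ : UniqueDiffOn ℝ J) (hy : ContDiffOn ℝ r y J) {k e : ℕ} (h : k + e ≤ r) :
    ContDiffOn ℝ e (fun t => jet J y t k) J :=
  ContDiffOn.iteratedDerivWithin_of_add hJ k (hy.of_le (by exact_mod_cast (by omega)))

lemma row_jet_contDiffOn (hL : L.SmoothOn r J) (hJ : UniqueDiffOn ℝ J) (hy : ContDiffOn ℝ r y J)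
    (j : ℕ) : ContDiffOn ℝ j (fun t => L.row r t (jet J y t) j) J :=
  row_contDiffOn hL le_rfl fun _ _ _ h => jet_contDiffOn hJ hy h

/-- The middle quasi-derivative `y^{[n]}`, `n = [r/2]`, is the last row of the form. -/
lemma quasiDeriv_mid (hr : 0 < r) (t : ℝ) :
    L.quasiDeriv r J y (r / 2) t = L.row r t (jet J y t) ((r + 1) / 2) := by
  have hmid : L.quasiDeriv r J y (r / 2) t = quasiDeriv.mid L r J y t := by
    rcases h : r / 2 with _ | k
    · simp [quasiDeriv, h]
    · simp [quasiDeriv, h]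
  rw [hmid, quasiDeriv.mid, row]
  rcases Nat.even_or_odd r with he | ho
  · have h1 : (r + 1) / 2 = r / 2 := by obtain ⟨k, rfl⟩ := he; omega
    have h2 : 2 * (r / 2) = r := by obtain ⟨k, rfl⟩ := he; omega
    have h3 : r / 2 ≠ 0 := by omega
    simp [he, h1, h2, h3, quasiDeriv.qterm, jet, sub_eq_add_neg]
  · have h1 : (r + 1) / 2 = r / 2 + 1 := by obtain ⟨k, rfl⟩ := ho; omega
    have h2 : 2 * (r / 2 + 1) = r + 1 := by obtain ⟨k, rfl⟩ := ho; omega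
    simp [Nat.not_even_iff_odd.2 ho, h1, h2, jet]

lemma quasiDeriv_succ {k : ℕ} (hk : r / 2 ≤ k) (hkr : k < r) (t : ℝ) :
    L.quasiDeriv r J y (k + 1) t =
      L.row r t (jet J y t) (r - (k + 1)) - derivWithin (L.quasiDeriv r J y k) J t := by
  have h1 : ¬ k + 1 < r / 2 := by omega
  have h2 : ¬ k + 1 = r / 2 := by omega
  have h3 : 2 * (r - (k + 1)) ≤ r := by omega
  have h4 : 2 * (r - (k + 1)) + 1 ≤ r := by omega
  rw [quasiDeriv]
  simp only [h1, h2, if_false, row, h3, h4, if_true, quasiDeriv.qterm, jet]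
  by_cases h5 : r - (k + 1) = 0
  · simp [h5]; abel
  · have h6 : 2 * (r - (k + 1)) ≤ r + 1 := by omega
    simp [h5, h6]; abel

lemma quasiDeriv_contDiffOn (hL : L.SmoothOn r J) (hJ : UniqueDiffOn ℝ J)
    (hy : ContDiffOn ℝ r y J) (hr : 0 < r) {k : ℕ} (hk : r / 2 ≤ k) (hkr : k ≤ r) :
    ContDiffOn ℝ (r - k : ℕ) (L.quasiDeriv r J y k) J := by
  induction k, hk using Nat.le_induction with
  | base =>
    have := row_jet_contDiffOn hL hJ hy ((r + 1) / 2)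
    rw [show r - r / 2 = (r + 1) / 2 by omega]
    exact this.congr fun t _ => quasiDeriv_mid hr t
  | succ k hk ih =>
    refine ContDiffOn.congr ?_ fun t _ => quasiDeriv_succ hk (by omega) t
    refine (row_jet_contDiffOn hL hJ hy _).sub ((ih (by omega)).derivWithin hJ ?_)
    exact_mod_cast (show r - (k + 1) + 1 ≤ r - k by omega)

lemma hasDerivWithinAt_quasiDeriv (hL : L.SmoothOn r J) (hJ : UniqueDiffOn ℝ J)
    (hy : ContDiffOn ℝ r y J) (hr : 0 < r) {k : ℕ} (hk : r / 2 ≤ k) (hkr : k < r) {t : ℝ}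
    (ht : t ∈ J) :
    HasDerivWithinAt (L.quasiDeriv r J y k)
      (L.row r t (jet J y t) (r - (k + 1)) - L.quasiDeriv r J y (k + 1) t) J t := by
  have h := ((quasiDeriv_contDiffOn hL hJ hy hr hk hkr.le).differentiableOn
    (by exact_mod_cast (by omega)) t ht).hasDerivWithinAt
  rwa [quasiDeriv_succ hk hkr, sub_sub_cancel]

lemma quasiDeriv_eq_sum (hL : L.SmoothOn r J) (hJ : UniqueDiffOn ℝ J)
    (hy : ContDiffOn ℝ r y J) (hr : 0 < r) {m : ℕ} (hm : m ≤ (r + 1) / 2) {t : ℝ} (ht : t ∈ J) :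
    L.quasiDeriv r J y (r / 2 + m) t = ∑ i ∈ Finset.range (m + 1), (-1 : ℂ) ^ i •
      iteratedDerivWithin i (fun u => L.row r u (jet J y u) ((r + 1) / 2 - m + i)) J t := by
  induction m generalizing t with
  | zero => simpa using quasiDeriv_mid hr t
  | succ m ih =>
    rw [← add_assoc, quasiDeriv_succ (by omega) (by omega), Finset.sum_range_succ']
    rw [derivWithin_congr (fun u hu => ih (by omega) hu) (ih (by omega) ht)]
    have hd : ∀ i ∈ Finset.range (m + 1), HasDerivWithinAt
        (fun u => (-1 : ℂ) ^ i • iteratedDerivWithin i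
          (fun u => L.row r u (jet J y u) ((r + 1) / 2 - m + i)) J u)
        ((-1 : ℂ) ^ i • iteratedDerivWithin (i + 1)
          (fun u => L.row r u (jet J y u) ((r + 1) / 2 - m + i)) J t) J t := fun i _ =>
      ((row_jet_contDiffOn hL hJ hy _).hasDerivWithinAt_iteratedDerivWithin hJ
        (by omega) ht).const_smul _
    rw [(HasDerivWithinAt.fun_sum hd).derivWithin (hJ t ht)]
    rw [sub_eq_add_neg, add_comm, ← Finset.sum_neg_distrib]
    congr 1
    · refine Finset.sum_congr rfl fun i _ => ?_
      rw [show (r + 1) / 2 - (m + 1) + (i + 1) = (r + 1) / 2 - m + i by omega, pow_succ]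
      simp
    · simp only [pow_zero, iteratedDerivWithin_zero, one_smul, add_zero]
      rw [show r - (r / 2 + m + 1) = (r + 1) / 2 - (m + 1) by omega]

/-- The expression `L` is its last quasi-derivative: `L[y] = y^{[r]}`. -/
lemma apply_eq_quasiDeriv (hL : L.SmoothOn r J) (hJ : UniqueDiffOn ℝ J)
    (hy : ContDiffOn ℝ r y J) (hr : 0 < r) {t : ℝ} (ht : t ∈ J) :
    L.apply r J y t = L.quasiDeriv r J y r t := by
  have h := quasiDeriv_eq_sum hL hJ hy hr le_rfl ht
  rw [show r / 2 + (r + 1) / 2 = r by omega] at h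
  have hs := sum_rows_eq r (Complex.I / 2)
    (fun j => (-1 : ℂ) ^ j • iteratedDerivWithin j (fun u => L.p j u (jet J y u j)) J t)
    (fun j => (-1 : ℂ) ^ (j - 1) • iteratedDerivWithin (j - 1) (fun u => L.s j u (jet J y u j)) J t)
    (fun j => (-1 : ℂ) ^ j •
      iteratedDerivWithin j (fun u => L.q j u (jet J y u (j - 1))) J t)
  rw [h, apply]
  convert hs.symm.trans ?_ using 1
  · congr 1
    · refine Finset.sum_congr rfl fun j _ => ?_
      rw [pow_mul, Complex.I_sq]; rfl
    · rw [Finset.smul_sum]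
      refine Finset.sum_congr rfl fun j hj => ?_
      obtain ⟨hj1, hj2⟩ := Finset.mem_Icc.1 hj
      obtain ⟨k, rfl⟩ : ∃ k, j = k + 1 := ⟨j - 1, by omega⟩
      obtain ⟨hq, hs⟩ := hL.2 (k + 1) hj1 (by omega)
      have h1 : ContDiffOn ℝ (k + 1 : ℕ) (fun v => L.q (k + 1) v (iteratedDerivWithin k y J v)) J :=
        hq.clm_apply_complex (jet_contDiffOn hJ hy (by omega))
      have h2 : ContDiffOn ℝ k
          (fun v => L.s (k + 1) v (iteratedDerivWithin (k + 1) y J v)) J :=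
        (hs.of_le (by exact_mod_cast (by omega))).clm_apply_complex
          (jet_contDiffOn hJ hy (by omega))
      have h3 : ContDiffOn ℝ k
          (derivWithin (fun v => L.q (k + 1) v (iteratedDerivWithin k y J v)) J) J :=
        h1.derivWithin hJ (by norm_cast)
      simp only [Nat.add_sub_cancel, jet]
      have h4 : iteratedDerivWithin k
          (derivWithin (fun v => L.q (k + 1) v (iteratedDerivWithin k y J v)) J) J t =
          iteratedDerivWithin (k + 1)
            (fun v => L.q (k + 1) v (iteratedDerivWithin k y J v)) J t := by
        rw [iteratedDerivWithin_succ']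
      rw [iteratedDerivWithin_fun_add ht hJ (h3 t ht) (h2 t ht), h4]
      rw [show 2 * (k + 1) - 1 = 2 * k + 1 by omega, pow_succ, pow_mul, Complex.I_sq, pow_succ]
      module
  · refine Finset.sum_congr rfl fun j hj => ?_
    have hjc : j ≤ (r + 1) / 2 := by simpa [Nat.lt_succ_iff] using hj
    rw [Nat.sub_self, zero_add]
    unfold row
    have hp : ContDiffOn ℝ j (fun u => if 2 * j ≤ r then L.p j u (jet J y u j) else 0) J := by
      by_cases h : 2 * j ≤ r
      · simp only [h, if_true]
        exact (hL.1 j h).clm_apply_complex (jet_contDiffOn hJ hy (by omega))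
      · simp only [h, if_false]; exact contDiffOn_const
    have hs : ContDiffOn ℝ j
        (fun u => if 2 * j + 1 ≤ r then L.s (j + 1) u (jet J y u (j + 1)) else 0) J := by
      by_cases h : 2 * j + 1 ≤ r
      · simp only [h, if_true]
        exact ((hL.2 (j + 1) (by omega) (by omega)).2.of_le
          (by exact_mod_cast (by omega))).clm_apply_complex (jet_contDiffOn hJ hy (by omega))
      · simp only [h, if_false]; exact contDiffOn_const
    have hq : ContDiffOn ℝ j
        (fun u => if j ≠ 0 ∧ 2 * j ≤ r + 1 then L.q j u (jet J y u (j - 1)) else 0) J := by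
      by_cases h : j ≠ 0 ∧ 2 * j ≤ r + 1
      · simp only [if_pos h]
        exact (hL.2 j (by omega) (by omega)).1.clm_apply_complex (jet_contDiffOn hJ hy (by omega))
      · simp only [h, if_false]; exact contDiffOn_const
    have hsq := hs.sub hq
    rw [iteratedDerivWithin_fun_add ht hJ (hp t ht) ((hsq.const_smul (Complex.I / 2)) t ht),
      iteratedDerivWithin_fun_const_smul ht hJ (Complex.I / 2) (hsq t ht)]
    have e := iteratedDerivWithin_sub ht hJ (hs t ht) (hq t ht)
    simp only [Pi.sub_def] at e
    rw [e]
    split_ifs <;> simp [iteratedDerivWithin_fun_const_zero] <;> module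

end Quasi

end DiffExpr

end

/-! ### The first order system -/

noncomputable section

namespace DiffExpr

variable {H : Type*} [NormedAddCommGroup H] [InnerProductSpace ℂ H]

/-- The `k`-th coordinate on `H^r`, read as `0` for `k ≥ r`. -/
def coord (r k : ℕ) : HilbPow H r →L[ℂ] H :=
  if h : k < r then PiLp.proj 2 (fun _ : Fin r => H) ⟨k, h⟩ else 0

lemma coord_apply {r k : ℕ} (h : k < r) (X : HilbPow H r) : coord r k X = X ⟨k, h⟩ := by
  simp [coord, h]

lemma coord_of_le {r k : ℕ} (h : r ≤ k) (X : HilbPow H r) : coord r k X = 0 := by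
  simp [coord, Nat.not_lt.2 h]

/-- The phase vector of `y` for the expression `L` of order `r`: the derivatives `y^{(k)}` for
`k < [(r+1)/2]` and the quasi-derivatives `y^{[k]}` for `[(r+1)/2] ≤ k < r`. Its components are those
of `vec L m r s J y 0` in another order and, for `y^{(n)}` in odd order, without the factor `-i`. -/
def phase (L : DiffExpr H) (r : ℕ) (J : Set ℝ) (y : ℝ → H) (t : ℝ) : HilbPow H r :=
  WithLp.toLp 2 fun k : Fin r =>
    if (k : ℕ) < (r + 1) / 2 then jet J y t k else L.quasiDeriv r J y k t

/-- The coefficient of the highest derivative `y^{(c)}` in `y^{[c]}`, `c = [(r+1)/2]`. -/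
def lead (L : DiffExpr H) (r : ℕ) (t : ℝ) : H →L[ℂ] H :=
  if Even r then L.p (r / 2) t
  else (Complex.I / 2) • (L.q (r / 2 + 1) t + L.s (r / 2 + 1) t)

/-- Minus the coefficient of `y^{(c-1)}` in `y^{[c]}`, `c = [(r+1)/2]`. -/
def sub₁ (L : DiffExpr H) (r : ℕ) (J : Set ℝ) (t : ℝ) : H →L[ℂ] H :=
  if Even r then (Complex.I / 2) • L.q (r / 2) t
  else -((Complex.I / 2) • derivWithin (L.q (r / 2 + 1)) J t) - L.p (r / 2) t

/-- Minus the coefficient of `y^{(c-2)}` in `y^{[c]}`, `c = [(r+1)/2]`; it is `0` for `r = 1`, where there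
is no such derivative. -/
def sub₂ (L : DiffExpr H) (r : ℕ) (t : ℝ) : H →L[ℂ] H :=
  if Even r ∨ r / 2 = 0 then 0 else (Complex.I / 2) • L.q (r / 2) t

lemma isUnit_lead {L : DiffExpr H} {r : ℕ} {t : ℝ} (h : L.LeadingInvertible r t) :
    IsUnit (L.lead r t) := by
  unfold LeadingInvertible at h
  unfold lead
  split_ifs at h ⊢ with he
  · exact h
  · have hI : (Complex.I / 2 : ℂ) ≠ 0 := by simp
    rw [Algebra.smul_def]
    exact (hI.isUnit.map (algebraMap ℂ (H →L[ℂ] H))).mul h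

section Smooth

variable {L : DiffExpr H} {r : ℕ} {J : Set ℝ}

lemma lead_contDiffOn (hL : L.SmoothOn r J) : ContDiffOn ℝ (r / 2 : ℕ) (L.lead r) J := by
  unfold lead
  split_ifs with he
  · exact hL.1 _ (by omega)
  · have ho : 2 * (r / 2 + 1) ≤ r + 1 := by
      obtain ⟨k, rfl⟩ := Nat.not_even_iff_odd.1 he; omega
    have h := hL.2 (r / 2 + 1) (by omega) ho
    exact ((h.1.add h.2).const_smul _).of_le (by exact_mod_cast (by omega))

lemma sub₁_contDiffOn (hL : L.SmoothOn r J) (hJ : UniqueDiffOn ℝ J) (hr : 0 < r) :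
    ContDiffOn ℝ (r / 2 : ℕ) (L.sub₁ r J) J := by
  unfold sub₁
  split_ifs with he
  · have h0 : 1 ≤ r / 2 := by obtain ⟨k, rfl⟩ := he; omega
    exact (hL.2 _ h0 (by omega)).1.const_smul _
  · have ho : 2 * (r / 2 + 1) ≤ r + 1 := by
      obtain ⟨k, rfl⟩ := Nat.not_even_iff_odd.1 he; omega
    have h := (hL.2 (r / 2 + 1) (by omega) ho).1
    exact ((h.derivWithin hJ (by norm_cast)).const_smul _).neg.sub (hL.1 _ (by omega))

lemma sub₂_contDiffOn (hL : L.SmoothOn r J) : ContDiffOn ℝ (r / 2 : ℕ) (L.sub₂ r) J := by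
  unfold sub₂
  split_ifs with he
  · exact contDiffOn_const
  · exact (hL.2 _ (by omega) (by omega)).1.const_smul _

/-- The first quasi-derivative beyond the lower half, in terms of the derivatives of `y`. -/
lemma quasiDeriv_top (hL : L.SmoothOn r J) (hJ : UniqueDiffOn ℝ J) {y : ℝ → H}
    (hy : ContDiffOn ℝ r y J) (hr : 0 < r) {t : ℝ} (ht : t ∈ J) :
    L.quasiDeriv r J y ((r + 1) / 2) t = L.lead r t (jet J y t ((r + 1) / 2))
      - L.sub₁ r J t (jet J y t ((r + 1) / 2 - 1)) - L.sub₂ r t (jet J y t ((r + 1) / 2 - 2)) := by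
  rcases Nat.even_or_odd r with he | ho
  · obtain ⟨k, hk⟩ := he
    have he : Even r := ⟨k, hk⟩
    have h1 : (r + 1) / 2 = r / 2 := by omega
    have h3 : r / 2 ≠ 0 := by omega
    have h4 : 2 * (r / 2) = r := by omega
    have := quasiDeriv_mid (L := L) (J := J) (y := y) hr t
    rw [h1] at this ⊢
    rw [this]
    simp [row, h4, h3, lead, sub₁, sub₂, he, sub_eq_add_neg]
  · have he := Nat.not_even_iff_odd.2 ho
    obtain ⟨k, hk⟩ := ho
    have h1 : (r + 1) / 2 = r / 2 + 1 := by omega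
    have h2 : ∀ u, L.quasiDeriv r J y (r / 2) u =
        -((Complex.I / 2) • L.q (r / 2 + 1) u (jet J y u (r / 2))) := by
      intro u
      rw [quasiDeriv_mid hr, h1, row]
      have h5 : ¬ 2 * (r / 2 + 1) ≤ r := by omega
      have h6 : ¬ 2 * (r / 2 + 1) + 1 ≤ r := by omega
      have h7 : 2 * (r / 2 + 1) ≤ r + 1 := by omega
      simp [h5, h6, h7]
    have hq := (hL.2 (r / 2 + 1) (by omega) (by omega)).1
    have hd : HasDerivWithinAt (L.quasiDeriv r J y (r / 2))
        (-((Complex.I / 2) • (derivWithin (L.q (r / 2 + 1)) J t (jet J y t (r / 2))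
          + L.q (r / 2 + 1) t (jet J y t (r / 2 + 1))))) J t := by
      have h8 := (((hq.differentiableOn (by simp) t ht).hasDerivWithinAt.clm_apply_complex
        (hy.hasDerivWithinAt_iteratedDerivWithin hJ (k := r / 2) (by omega) ht)).const_smul
          (Complex.I / 2)).neg
      exact h8.congr (fun u _ => h2 u) (h2 t)
    rw [h1, quasiDeriv_succ le_rfl (by omega), hd.derivWithin (hJ t ht),
      show r - (r / 2 + 1) = r / 2 by omega, row]
    have h5 : 2 * (r / 2) ≤ r := by omega
    have h6 : 2 * (r / 2) + 1 ≤ r := by omega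
    have h7 : 2 * (r / 2) ≤ r + 1 := by omega
    simp only [h5, h6, h7, if_true, and_true, lead, sub₁, sub₂, he, if_false, false_or,
      Nat.add_sub_cancel, show r / 2 + 1 - 2 = r / 2 - 1 by omega]
    split_ifs <;> first | omega | (simp; module)

end Smooth

/-- The derivatives `y^{(k)}`, `k ≤ c = [(r+1)/2]`, as functions of the phase vector of a solution.
-/
def jetOp (L : DiffExpr H) (r : ℕ) (J : Set ℝ) (t : ℝ) (k : ℕ) : HilbPow H r →L[ℂ] H :=
  if k < (r + 1) / 2 then coord r k
  else (Ring.inverse (L.lead r t)).comp (coord r ((r + 1) / 2)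
    + (L.sub₁ r J t).comp (coord r ((r + 1) / 2 - 1))
    + (L.sub₂ r t).comp (coord r ((r + 1) / 2 - 2)))

/-- The row of the form of `L` as an operator, when the entries are operators. -/
def rowOp {E : Type*} [NormedAddCommGroup E] [NormedSpace ℂ E] (L : DiffExpr H) (r : ℕ) (t : ℝ)
    (T : ℕ → E →L[ℂ] H) (j : ℕ) : E →L[ℂ] H :=
  (if 2 * j ≤ r then (L.p j t).comp (T j) else 0)
    + (Complex.I / 2) • ((if 2 * j + 1 ≤ r then (L.s (j + 1) t).comp (T (j + 1)) else 0)
      - (if j ≠ 0 ∧ 2 * j ≤ r + 1 then (L.q j t).comp (T (j - 1)) else 0))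

lemma rowOp_apply {E : Type*} [NormedAddCommGroup E] [NormedSpace ℂ E] (L : DiffExpr H) (r : ℕ)
    (t : ℝ) (T : ℕ → E →L[ℂ] H) (j : ℕ) (X : E) :
    L.rowOp r t T j X = L.row r t (fun k => T k X) j := by
  unfold rowOp row
  split_ifs <;> simp

/-- The `k`-th equation of the first order system equivalent to `L[y] = 0`. -/
def systemRow (L : DiffExpr H) (r : ℕ) (J : Set ℝ) (t : ℝ) (k : ℕ) : HilbPow H r →L[ℂ] H :=
  if k < (r + 1) / 2 then L.jetOp r J t (k + 1)
  else L.rowOp r t (L.jetOp r J t) (r - (k + 1)) - coord r (k + 1)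

/-- The operator `A(t)` of the first order system `X' = A(t) X` for the phase vector `X` of a
solution of `L[y] = 0`. -/
def systemOp (L : DiffExpr H) (r : ℕ) (J : Set ℝ) (t : ℝ) : HilbPow H r →L[ℂ] HilbPow H r :=
  ∑ k : Fin r, (((PiLp.continuousLinearEquiv 2 ℂ
    (fun _ : Fin r => H)).symm.toContinuousLinearMap).comp
      (ContinuousLinearMap.single ℂ (fun _ : Fin r => H) k)).comp (L.systemRow r J t k)

lemma systemOp_apply (L : DiffExpr H) (r : ℕ) (J : Set ℝ) (t : ℝ) (X : HilbPow H r) (k : Fin r) :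
    L.systemOp r J t X k = L.systemRow r J t k X := by
  simp [systemOp, Pi.single_apply]

section Continuity

variable {L : DiffExpr H} {r : ℕ} {J : Set ℝ}

lemma jetOp_continuousOn [CompleteSpace H] (hL : L.SmoothOn r J) (hJ : UniqueDiffOn ℝ J)
    (hr : 0 < r) (hinv : ∀ t ∈ J, L.LeadingInvertible r t) (k : ℕ) :
    ContinuousOn (fun t => L.jetOp r J t k) J := by
  unfold jetOp
  split_ifs
  · exact continuousOn_const
  · refine ((lead_contDiffOn hL).ringInverse fun t ht =>
      isUnit_lead (hinv t ht)).continuousOn.clm_comp ?_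
    exact (continuousOn_const.add
      ((sub₁_contDiffOn hL hJ hr).continuousOn.clm_comp continuousOn_const)).add
        ((sub₂_contDiffOn hL).continuousOn.clm_comp continuousOn_const)

lemma rowOp_continuousOn {E : Type*} [NormedAddCommGroup E] [NormedSpace ℂ E]
    (hL : L.SmoothOn r J) {T : ℝ → ℕ → E →L[ℂ] H} (hT : ∀ k, ContinuousOn (fun t => T t k) J)
    (j : ℕ) :
    ContinuousOn (fun t => L.rowOp r t (T t) j) J := by
  unfold rowOp
  refine ContinuousOn.add ?_ (ContinuousOn.fun_smul continuousOn_const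
    (ContinuousOn.fun_sub ?_ ?_))
  · by_cases h : 2 * j ≤ r
    · simp only [if_pos h]
      exact (hL.1 j h).continuousOn.clm_comp (hT j)
    · simp only [if_neg h]; exact continuousOn_const
  · by_cases h : 2 * j + 1 ≤ r
    · simp only [if_pos h]
      exact (hL.2 (j + 1) (by omega) (by omega)).2.continuousOn.clm_comp (hT (j + 1))
    · simp only [if_neg h]; exact continuousOn_const
  · by_cases h : j ≠ 0 ∧ 2 * j ≤ r + 1
    · simp only [if_pos h]
      exact (hL.2 j (by omega) (by omega)).1.continuousOn.clm_comp (hT (j - 1))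
    · simp only [if_neg h]; exact continuousOn_const

lemma systemOp_continuousOn [CompleteSpace H] (hL : L.SmoothOn r J) (hJ : UniqueDiffOn ℝ J)
    (hr : 0 < r) (hinv : ∀ t ∈ J, L.LeadingInvertible r t) :
    ContinuousOn (L.systemOp r J) J := by
  unfold systemOp
  refine continuousOn_finsetSum _ fun k _ => continuousOn_const.clm_comp ?_
  unfold systemRow
  split_ifs
  · exact jetOp_continuousOn hL hJ hr hinv _
  · exact (rowOp_continuousOn hL (fun k => jetOp_continuousOn hL hJ hr hinv k) _).sub
      continuousOn_const

end Continuity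

lemma jetOp_of_lt (L : DiffExpr H) {r k : ℕ} (J : Set ℝ) (t : ℝ) (h : k < (r + 1) / 2) :
    L.jetOp r J t k = coord r k := by simp [jetOp, h]

lemma hasDerivWithinAt_coord {r : ℕ} {J : Set ℝ} {X : ℝ → HilbPow H r} {X' : HilbPow H r} {t : ℝ}
    (hX : HasDerivWithinAt X X' J t) (k : ℕ) :
    HasDerivWithinAt (fun u => coord r k (X u)) (coord r k X') J t :=
  (((coord r k).restrictScalars ℝ).hasFDerivAt (x := X t)).comp_hasDerivWithinAt t hX

/-- Solutions of the first order system yield `C^r` solutions of `L[y] = 0`: for every initial phase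
vector at `0` there is a solution on the whole interval. -/
lemma exists_solution_phase_eq [CompleteSpace H] {L : DiffExpr H} {r : ℕ} {a b : ℝ} (hab : a < b)
    (h0 : (0 : ℝ) ∈ Icc a b) (hr : 0 < r) (hL : L.SmoothOn r (Icc a b))
    (hinv : ∀ t ∈ Icc a b, L.LeadingInvertible r t) (X₀ : HilbPow H r) :
    ∃ y : ℝ → H, ContDiffOn ℝ r y (Icc a b) ∧ (∀ t ∈ Icc a b, L.apply r (Icc a b) y t = 0) ∧
      L.phase r (Icc a b) y 0 = X₀ := by
  set J := Icc a b with hJdef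
  have hJ : UniqueDiffOn ℝ J := uniqueDiffOn_Icc hab
  obtain ⟨X, hX0, hX⟩ := exists_solution_linearODE h0 (systemOp_continuousOn hL hJ hr hinv) X₀
  set c := (r + 1) / 2 with hc
  set x : ℕ → ℝ → H := fun k t => L.jetOp r J t k (X t) with hx
  set u : ℕ → ℝ → H := fun k t => coord r k (X t) with hu
  have hXc : ContinuousOn X J := fun t ht => (hX t ht).continuousWithinAt
  -- `u k` are the coordinates of `X`, and `x k` will be the derivatives of `x 0 = u 0`
  have hxu : ∀ k, k < c → x k = u k := fun k hk => by
    funext t; simp only [hx, hu, jetOp_of_lt L J t hk]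
  have hxc : ∀ t, x c t = Ring.inverse (L.lead r t)
      (u c t + L.sub₁ r J t (u (c - 1) t) + L.sub₂ r t (u (c - 2) t)) := fun t => by
    simp [hx, hu, jetOp, ← hc]
  have hder : ∀ k, k < r → ∀ t ∈ J, HasDerivWithinAt (u k) (L.systemRow r J t k (X t)) J t := by
    intro k hk t ht
    have h := hasDerivWithinAt_coord (hX t ht) k
    rwa [coord_apply hk, systemOp_apply] at h
  have hder₁ : ∀ k, k < c → ∀ t ∈ J, HasDerivWithinAt (x k) (x (k + 1) t) J t := by
    intro k hk t ht
    have h := hder k (by omega) t ht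
    rw [systemRow, if_pos hk] at h
    rwa [hxu k hk]
  have hder₂ : ∀ k, c ≤ k → k < r → ∀ t ∈ J, HasDerivWithinAt (u k)
      (L.row r t (fun i => x i t) (r - (k + 1)) - u (k + 1) t) J t := by
    intro k hk hkr t ht
    have h := hder k hkr t ht
    rwa [systemRow, if_neg (by omega), sub_apply, rowOp_apply] at h
  -- regularity: each step of the induction gains one derivative
  have hboot : ∀ e, e ≤ r / 2 → (∀ k, k ≤ c → ContDiffOn ℝ e (x k) J) ∧
      (∀ k, c ≤ k → k ≤ r → ContDiffOn ℝ (min e (r - k) : ℕ) (u k) J) := by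
    intro e
    induction e with
    | zero =>
      intro _
      constructor
      · intro k _
        exact contDiffOn_zero.2 ((jetOp_continuousOn hL hJ hr hinv k).clm_apply hXc)
      · intro k _ _
        rw [Nat.zero_min]
        exact contDiffOn_zero.2 ((coord r k).continuous.comp_continuousOn hXc)
    | succ e ih =>
      intro he
      obtain ⟨ih₁, ih₂⟩ := ih (by omega)
      have h₂ : ∀ k, c ≤ k → k ≤ r → ContDiffOn ℝ (min (e + 1) (r - k) : ℕ) (u k) J := by
        intro k hk hkr
        rcases hkr.eq_or_lt with rfl | hkr
        · have : u k = fun _ => 0 := by funext t; exact coord_of_le le_rfl _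
          rw [this]; exact contDiffOn_const
        · rw [show min (e + 1) (r - k) = min e (r - (k + 1)) + 1 by omega]
          refine contDiffOn_succ_of_hasDerivWithinAt hJ (hder₂ k hk hkr) (ContDiffOn.sub ?_ ?_)
          · refine row_contDiffOn (x := fun t i => x i t) hL (by omega) fun i _ _ _ => ?_
            exact (ih₁ i (by omega)).of_le (by exact_mod_cast (by omega))
          · exact ih₂ (k + 1) (by omega) (by omega)
      have h₁ : ∀ k, k < c → ContDiffOn ℝ (e + 1 : ℕ) (x k) J := fun k hk =>
        contDiffOn_succ_of_hasDerivWithinAt hJ (hder₁ k hk) (ih₁ (k + 1) hk)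
      refine ⟨fun k hk => ?_, h₂⟩
      rcases hk.lt_or_eq with hk | rfl
      · exact h₁ k hk
      · have hle : ((e + 1 : ℕ) : WithTop ℕ∞) ≤ (r / 2 : ℕ) := by exact_mod_cast he
        rw [funext hxc]
        refine (((lead_contDiffOn hL).ringInverse fun t ht =>
          isUnit_lead (hinv t ht)).of_le hle).clm_apply_complex
            (ContDiffOn.add (ContDiffOn.add ?_ ?_) ?_)
        · have := h₂ c le_rfl (by omega)
          rwa [show min (e + 1) (r - c) = e + 1 by omega] at this
        · refine ((sub₁_contDiffOn hL hJ hr).of_le hle).clm_apply_complex ?_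
          rw [← hxu (c - 1) (by omega)]; exact h₁ _ (by omega)
        · refine ((sub₂_contDiffOn hL).of_le hle).clm_apply_complex ?_
          rw [← hxu (c - 2) (by omega)]; exact h₁ _ (by omega)
  have hxr : ∀ i, i ≤ c → ContDiffOn ℝ (r / 2 + i : ℕ) (x (c - i)) J := by
    intro i
    induction i with
    | zero => intro _; exact (hboot _ le_rfl).1 c le_rfl
    | succ i ih =>
      intro hi
      have h := ih (by omega)
      rw [show c - i = c - (i + 1) + 1 by omega] at h
      exact contDiffOn_succ_of_hasDerivWithinAt hJ (hder₁ _ (by omega)) h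
  have hy : ContDiffOn ℝ r (x 0) J := by
    have h := hxr c le_rfl
    rwa [Nat.sub_self, show r / 2 + c = r by omega] at h
  have hjet : ∀ k, k ≤ c → ∀ t ∈ J, jet J (x 0) t k = x k t := by
    intro k
    induction k with
    | zero => intro _ t _; simp [jet]
    | succ k ih =>
      intro hk t ht
      rw [jet, iteratedDerivWithin_succ]
      exact (derivWithin_congr (fun v hv => ih (by omega) v hv) (ih (by omega) t ht)).trans
        ((hder₁ k hk t ht).derivWithin (hJ t ht))
  have hquasi : ∀ k, c ≤ k → k ≤ r → ∀ t ∈ J, L.quasiDeriv r J (x 0) k t = u k t := by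
    intro k hk
    induction k, hk using Nat.le_induction with
    | base =>
      intro _ t ht
      have hcanc : L.lead r t (x c t) =
          u c t + L.sub₁ r J t (u (c - 1) t) + L.sub₂ r t (u (c - 2) t) := by
        rw [hxc, ← ContinuousLinearMap.comp_apply, ← ContinuousLinearMap.mul_def,
          Ring.mul_inverse_cancel _ (isUnit_lead (hinv t ht))]
        rfl
      rw [quasiDeriv_top hL hJ hy hr ht, hjet c le_rfl t ht, hjet _ (by omega) t ht,
        hjet _ (by omega) t ht, hcanc, hxu (c - 1) (by omega), hxu (c - 2) (by omega)]
      abel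
    | succ k hk ih =>
      intro hkr t ht
      rw [quasiDeriv_succ (by omega) (by omega),
        derivWithin_congr (fun v hv => ih (by omega) v hv) (ih (by omega) t ht),
        (hder₂ k hk (by omega) t ht).derivWithin (hJ t ht),
        row_congr_right L t (x' := fun i => x i t) fun i _ _ _ => hjet i (by omega) t ht]
      abel
  refine ⟨x 0, hy, fun t ht => ?_, ?_⟩
  · rw [apply_eq_quasiDeriv hL hJ hy hr ht, hquasi r (by omega) le_rfl t ht]
    exact coord_of_le le_rfl _
  · rw [← hX0]
    ext k
    have hcoord : X 0 k = u k 0 := (coord_apply k.2 (X 0)).symm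
    simp only [phase, hcoord]
    split_ifs with hk
    · rw [hjet k hk.le 0 h0, hxu k hk]
    · exact hquasi k (not_lt.1 hk) k.2.le 0 h0

end DiffExpr

end

/-! ### Nonnegative symmetric forms -/

noncomputable section

namespace DiffExpr

variable {H : Type*} [NormedAddCommGroup H] [InnerProductSpace ℂ H]

lemma row_smul (L : DiffExpr H) (r : ℕ) (t : ℝ) (c : ℂ) (x : ℕ → H) (j : ℕ) :
    L.row r t (fun k => c • x k) j = c • L.row r t x j := by
  unfold row
  split_ifs <;> simp only [map_smul, smul_sub, smul_add, sub_zero, smul_zero, add_zero] <;> module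

lemma vecForm_congr {L L' : DiffExpr H} {r : ℕ} {J : Set ℝ} (h : L.EqOn L' r J) {t : ℝ} (ht : t ∈ J)
    (x g : ℕ → H) : L.vecForm r t x g = L'.vecForm r t x g := by
  simp only [vecForm_eq_sum_row, row_congr h ht]

lemma vecForm_sub_left (L : DiffExpr H) (r : ℕ) (t : ℝ) (x x' g : ℕ → H) :
    L.vecForm r t (fun k => x k - x' k) g = L.vecForm r t x g - L.vecForm r t x' g := by
  simp only [vecForm_eq_sum_row, row_sub, inner_sub_right, Finset.sum_sub_distrib]

lemma vecForm_sub_right (L : DiffExpr H) (r : ℕ) (t : ℝ) (x g g' : ℕ → H) :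
    L.vecForm r t x (fun k => g k - g' k) = L.vecForm r t x g - L.vecForm r t x g' := by
  simp only [vecForm_eq_sum_row, inner_sub_left, Finset.sum_sub_distrib]

lemma vecForm_smul_left (L : DiffExpr H) (r : ℕ) (t : ℝ) (c : ℂ) (x g : ℕ → H) :
    L.vecForm r t (fun k => c • x k) g = c * L.vecForm r t x g := by
  simp only [vecForm_eq_sum_row, row_smul, inner_smul_right, Finset.mul_sum]

lemma vecForm_smul_right (L : DiffExpr H) (r : ℕ) (t : ℝ) (c : ℂ) (x g : ℕ → H) :
    L.vecForm r t x (fun k => c • g k) = conj c * L.vecForm r t x g := by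
  simp only [vecForm_eq_sum_row, inner_smul_left, Finset.mul_sum]

lemma vecForm_single_right (L : DiffExpr H) (r : ℕ) (t : ℝ) (x : ℕ → H) {j : ℕ}
    (hj : j ≤ (r + 1) / 2) (u : H) :
    L.vecForm r t x (Pi.single j u) = inner ℂ u (L.row r t x j) := by
  rw [vecForm_eq_sum_row, Finset.sum_eq_single j]
  · simp
  · intro i _ hi
    simp [Pi.single_eq_of_ne hi]
  · intro h; exact absurd (Finset.mem_range.2 (by omega)) h

/-- The parallelogram inequality for a nonnegative form. -/
lemma vecForm_re_le_of_nonneg {L : DiffExpr H} {r : ℕ} {t : ℝ}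
    (hnn : ∀ x : ℕ → H, 0 ≤ (L.vecForm r t x x).re) (x x' : ℕ → H) :
    (L.vecForm r t x' x').re ≤ 2 * (L.vecForm r t x x).re
      + 2 * (L.vecForm r t (fun k => x k - x' k) (fun k => x k - x' k)).re := by
  have h := hnn (fun k => x k - (x' k - x k))
  simp only [vecForm_sub_left, vecForm_sub_right, Complex.sub_re] at h ⊢
  linarith

section Compact

variable {L : DiffExpr H} {r : ℕ} {a b : ℝ}

/-- The rows of the form of a smooth expression are bounded uniformly in `t ∈ [a, b]`. -/
lemma exists_norm_row_le (hL : L.SmoothOn r (Icc a b)) :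
    ∃ C : ℝ, 0 ≤ C ∧ ∀ t ∈ Icc a b, ∀ j, j ≤ (r + 1) / 2 → ∀ (x : ℕ → H) (ε : ℝ), 0 ≤ ε →
      (∀ i, i ≤ (r + 1) / 2 → ‖x i‖ ≤ ε) → ‖L.row r t x j‖ ≤ C * ε := by
  set c := (r + 1) / 2 with hc
  let T : ℕ → (Fin (c + 1) → H) →L[ℂ] H := fun i =>
    if h : i < c + 1 then ContinuousLinearMap.proj ⟨i, h⟩ else 0
  have hb : ∀ j, ∃ C, ∀ t ∈ Icc a b, ‖L.rowOp r t T j‖ ≤ C := fun j =>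
    isCompact_Icc.exists_bound_of_continuousOn
      (rowOp_continuousOn (T := fun _ => T) hL (fun _ => continuousOn_const) j)
  choose C hC using hb
  refine ⟨∑ j ∈ Finset.range (c + 1), |C j|, Finset.sum_nonneg fun _ _ => abs_nonneg _, ?_⟩
  intro t ht j hj x ε hε hx
  have h1 : L.row r t x j = L.rowOp r t T j (fun i => x i) := by
    rw [rowOp_apply]
    refine row_congr_right L t fun k h1 h2 h3 => ?_
    have : k ≤ c := by omega
    simp [T, this]
  rw [h1]
  refine ((L.rowOp r t T j).le_opNorm _).trans (mul_le_mul ?_ ?_ (norm_nonneg _)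
    (Finset.sum_nonneg fun _ _ => abs_nonneg _))
  · exact ((hC j t ht).trans (le_abs_self _)).trans
      (Finset.single_le_sum (f := fun j => |C j|) (fun _ _ => abs_nonneg _)
        (Finset.mem_range.2 (by omega)))
  · exact (pi_norm_le_iff_of_nonneg hε).2 fun i => hx i (by omega)

lemma exists_norm_p_le (hL : L.SmoothOn r (Icc a b)) :
    ∃ C : ℝ, 0 < C ∧ ∀ t ∈ Icc a b, ∀ j, 2 * j ≤ r → ‖L.p j t‖ ≤ C := by
  have hb : ∀ j, ∃ C, 2 * j ≤ r → ∀ t ∈ Icc a b, ‖L.p j t‖ ≤ C := fun j => by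
    by_cases h : 2 * j ≤ r
    · obtain ⟨C, hC⟩ := isCompact_Icc.exists_bound_of_continuousOn (hL.1 j h).continuousOn
      exact ⟨C, fun _ => hC⟩
    · exact ⟨0, fun h' => absurd h' h⟩
  choose C hC using hb
  refine ⟨∑ j ∈ Finset.range (r + 1), |C j| + 1,
    add_pos_of_nonneg_of_pos (Finset.sum_nonneg fun _ _ => abs_nonneg _) one_pos, ?_⟩
  intro t ht j hj
  have h1 := Finset.single_le_sum (f := fun j => |C j|) (fun _ _ => abs_nonneg _)
        (Finset.mem_range.2 (show j < r + 1 by omega))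
  have h2 := (hC j hj t ht).trans (le_abs_self _)
  linarith

lemma form_continuousOn (hab : a < b) (hL : L.SmoothOn r (Icc a b)) {y : ℝ → H}
    (hy : ContDiffOn ℝ r y (Icc a b)) : ContinuousOn (L.form r (Icc a b) y y) (Icc a b) := by
  have hJ := uniqueDiffOn_Icc hab
  have h : L.form r (Icc a b) y y = fun t => ∑ j ∈ Finset.range ((r + 1) / 2 + 1),
      inner ℂ (jet (Icc a b) y t j) (L.row r t (jet (Icc a b) y t) j) := by
    funext t; exact vecForm_eq_sum_row L r t _ _
  rw [h]
  refine continuousOn_finsetSum _ fun j hj => ContinuousOn.inner (𝕜 := ℂ) ?_ ?_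
  · have := Finset.mem_range.1 hj
    exact (jet_contDiffOn (e := 0) hJ hy (by omega)).continuousOn
  · exact (row_jet_contDiffOn hL hJ hy j).continuousOn

end Compact

variable [CompleteSpace H]

lemma vecForm_adj (L : DiffExpr H) (r : ℕ) (t : ℝ) (x g : ℕ → H) :
    L.adj.vecForm r t x g = conj (L.vecForm r t g x) := by
  simp only [vecForm, adj, map_add, map_sum, map_mul, map_sub, inner_conj_symm,
    ContinuousLinearMap.adjoint_inner_right, map_div₀, Complex.conj_I, map_ofNat]
  congr 1
  rw [neg_div, neg_mul, ← mul_neg, ← Finset.sum_neg_distrib]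
  simp only [neg_sub]

/-- A nonnegative symmetric form controls its rows, by the Cauchy–Schwarz inequality. The bound `C`
is one for the diagonal coefficient `p_j` and may be any positive number in a row without one. -/
lemma norm_row_sq_le {L : DiffExpr H} {r : ℕ} {J : Set ℝ} (hsymm : L.EqOn L.adj r J) {t : ℝ}
    (ht : t ∈ J) (hnn : ∀ x : ℕ → H, 0 ≤ (L.vecForm r t x x).re) {j : ℕ} (hj : j ≤ (r + 1) / 2)
    {C : ℝ} (hC : 0 < C) (hp : 2 * j ≤ r → ‖L.p j t‖ ≤ C) (x : ℕ → H) :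
    ‖L.row r t x j‖ ^ 2 ≤ C * (L.vecForm r t x x).re := by
  set u := L.row r t x j with hu
  set g : ℕ → H := Pi.single j u with hg
  have h1 : L.vecForm r t x g = (‖u‖ ^ 2 : ℝ) := by
    rw [hg, vecForm_single_right L r t x hj, ← hu, inner_self_eq_norm_sq_to_K]; simp
  have h2 : L.vecForm r t g x = (‖u‖ ^ 2 : ℝ) := by
    rw [vecForm_congr hsymm ht, vecForm_adj, h1, Complex.conj_ofReal]
  have h3 : (L.vecForm r t g g).re ≤ C * ‖u‖ ^ 2 := by
    have h4 : L.row r t g j = if 2 * j ≤ r then L.p j t u else 0 := by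
      rw [row, hg]
      rcases Nat.eq_zero_or_pos j with rfl | h0
      · simp
      · have : j - 1 ≠ j := by omega
        simp [this]
    rw [hg, vecForm_single_right L r t _ hj, ← hg, h4]
    split_ifs with h5
    · refine ((Complex.re_le_norm _).trans (norm_inner_le_norm _ _)).trans ?_
      have := ((L.p j t).le_opNorm u).trans (mul_le_mul_of_nonneg_right (hp h5) (norm_nonneg u))
      nlinarith [norm_nonneg u]
    · simp; positivity
  -- expand `0 ≤ L⟨x - g / C, x - g / C⟩`
  have h5 := hnn (fun k => x k - (((1 / C : ℝ) : ℂ) • g k))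
  simp only [vecForm_sub_left, vecForm_sub_right, vecForm_smul_left, vecForm_smul_right, h1, h2,
    Complex.conj_ofReal, Complex.sub_re, Complex.re_ofReal_mul, Complex.ofReal_re] at h5
  have h6 : 1 / C * (1 / C * (L.vecForm r t g g).re) ≤ 1 / C * ‖u‖ ^ 2 := by
    refine mul_le_mul_of_nonneg_left ?_ (by positivity)
    rw [one_div, inv_mul_le_iff₀ hC]; exact h3
  have h7 : 1 / C * ‖u‖ ^ 2 ≤ (L.vecForm r t x x).re := by linarith
  rwa [one_div, inv_mul_le_iff₀ hC] at h7

/-- In a nonnegative symmetric form of odd order the last row vanishes: it has no diagonal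
coefficient. -/
lemma row_top_eq_zero {L : DiffExpr H} {r : ℕ} (hodd : ¬ Even r) {J : Set ℝ}
    (hsymm : L.EqOn L.adj r J) {t : ℝ} (ht : t ∈ J)
    (hnn : ∀ x : ℕ → H, 0 ≤ (L.vecForm r t x x).re) (x : ℕ → H) :
    L.row r t x ((r + 1) / 2) = 0 := by
  have hr : ¬ 2 * ((r + 1) / 2) ≤ r := by
    obtain ⟨k, rfl⟩ := Nat.not_even_iff_odd.1 hodd; omega
  have h : ∀ C : ℝ, 0 < C → ‖L.row r t x ((r + 1) / 2)‖ ^ 2 ≤ C * (L.vecForm r t x x).re :=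
    fun C hC => norm_row_sq_le hsymm ht hnn le_rfl hC (fun h => absurd h hr) x
  have hlim : Tendsto (fun C : ℝ => C * (L.vecForm r t x x).re) (𝓝[>] 0) (𝓝 0) := by
    have : Tendsto (fun C : ℝ => C * (L.vecForm r t x x).re) (𝓝 0)
        (𝓝 (0 * (L.vecForm r t x x).re)) := (continuous_id.mul continuous_const).tendsto _
    rw [zero_mul] at this
    exact this.mono_left nhdsWithin_le_nhds
  have h0 : ‖L.row r t x ((r + 1) / 2)‖ ^ 2 ≤ 0 :=
    ge_of_tendsto hlim (eventually_nhdsWithin_of_forall fun C hC => h C hC)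
  have : ‖L.row r t x ((r + 1) / 2)‖ = 0 := by
    have := norm_nonneg (L.row r t x ((r + 1) / 2))
    nlinarith
  exact norm_eq_zero.1 this

end DiffExpr

end

/-! ### Comparison of two expressions -/

noncomputable section

namespace DiffExpr

variable {H : Type*} [NormedAddCommGroup H] [InnerProductSpace ℂ H]

section Phase

variable {L L₁ : DiffExpr H} {r : ℕ} {J : Set ℝ} {y : ℝ → H}

lemma coord_phase_of_lt {k : ℕ} (hk : k < (r + 1) / 2) (t : ℝ) :
    coord r k (L.phase r J y t) = jet J y t k := by
  rw [coord_apply (by omega)]; simp [phase, hk]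

lemma coord_phase_of_le {t : ℝ} (h0 : L.quasiDeriv r J y r t = 0) {k : ℕ} (hk : (r + 1) / 2 ≤ k)
    (hkr : k ≤ r) : coord r k (L.phase r J y t) = L.quasiDeriv r J y k t := by
  rcases hkr.lt_or_eq with hkr | rfl
  · rw [coord_apply hkr]; simp [phase, Nat.not_lt.2 hk]
  · rw [coord_of_le le_rfl, h0]

lemma hasDerivWithinAt_phase (hL : L.SmoothOn r J) (hJ : UniqueDiffOn ℝ J)
    (hy : ContDiffOn ℝ r y J) (hr : 0 < r) {t : ℝ} (ht : t ∈ J) :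
    HasDerivWithinAt (L.phase r J y) (WithLp.toLp 2 fun k : Fin r =>
      if (k : ℕ) < (r + 1) / 2 then jet J y t (k + 1)
      else L.row r t (jet J y t) (r - (k + 1)) - L.quasiDeriv r J y (k + 1) t) J t := by
  have h : HasDerivWithinAt (fun u => fun k : Fin r =>
      if (k : ℕ) < (r + 1) / 2 then jet J y u k else L.quasiDeriv r J y k u)
      (fun k : Fin r => if (k : ℕ) < (r + 1) / 2 then jet J y t (k + 1)
      else L.row r t (jet J y t) (r - (k + 1)) - L.quasiDeriv r J y (k + 1) t) J t := by
    refine hasDerivWithinAt_pi.2 fun k => ?_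
    split_ifs with hk
    · exact hy.hasDerivWithinAt_iteratedDerivWithin hJ k.2 ht
    · exact hasDerivWithinAt_quasiDeriv hL hJ hy hr (by omega) k.2 ht
  exact (PiLp.continuousLinearEquiv 2 ℝ
    (fun _ : Fin r => H)).symm.toContinuousLinearMap.hasFDerivAt.comp_hasDerivWithinAt t h

/-- If the forms of `L` and `L₁` differ only in the entries up to `n = [r/2]`, then so do the first
quasi-derivatives beyond the lower half: no derivative of the coefficients of `L - L₁` enters. -/
lemma quasiDeriv_top_sub (hr : 0 < r)
    (hodd : ¬ Even r → ∀ t ∈ J, ∀ x, L.row r t x ((r + 1) / 2) = L₁.row r t x ((r + 1) / 2))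
    {t : ℝ} (ht : t ∈ J) :
    L.quasiDeriv r J y ((r + 1) / 2) t = L₁.quasiDeriv r J y ((r + 1) / 2) t
      + (L.row r t (jet J y t) (r / 2) - L₁.row r t (jet J y t) (r / 2)) := by
  by_cases he : Even r
  · have h1 : (r + 1) / 2 = r / 2 := by obtain ⟨k, rfl⟩ := he; omega
    have h2 := quasiDeriv_mid (L := L) (J := J) (y := y) hr t
    have h3 := quasiDeriv_mid (L := L₁) (J := J) (y := y) hr t
    rw [h1] at h2 h3 ⊢
    rw [h2, h3]; abel
  · have h1 : (r + 1) / 2 = r / 2 + 1 ∧ r - (r / 2 + 1) = r / 2 ∧ r / 2 < r := by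
      obtain ⟨k, rfl⟩ := Nat.not_even_iff_odd.1 he; omega
    -- the last row is the only one that is differentiated in `y^{[n+1]}`, and it is common to both
    have h2 : ∀ u ∈ J, L.quasiDeriv r J y (r / 2) u =
        L₁.quasiDeriv r J y (r / 2) u := fun u hu => by
      rw [quasiDeriv_mid hr, quasiDeriv_mid hr, hodd he u hu]
    rw [h1.1, quasiDeriv_succ le_rfl h1.2.2, quasiDeriv_succ le_rfl h1.2.2, h1.2.1,
      derivWithin_congr h2 (h2 t ht)]
    abel

/-- The highest derivative of a solution of `L[y] = 0`, recovered by the formula for `L₁` from the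
phase vector for `L`. -/
lemma jetOp_phase_top [CompleteSpace H] (hL₁ : L₁.SmoothOn r J)
    (hJ : UniqueDiffOn ℝ J) (hy : ContDiffOn ℝ r y J) (hr : 0 < r)
    (hinv : ∀ t ∈ J, L₁.LeadingInvertible r t)
    (hodd : ¬ Even r → ∀ t ∈ J, ∀ x, L.row r t x ((r + 1) / 2) = L₁.row r t x ((r + 1) / 2))
    {t : ℝ} (ht : t ∈ J) (h0 : L.quasiDeriv r J y r t = 0) :
    L₁.jetOp r J t ((r + 1) / 2) (L.phase r J y t) = jet J y t ((r + 1) / 2)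
      + Ring.inverse (L₁.lead r t)
          (L.row r t (jet J y t) (r / 2) - L₁.row r t (jet J y t) (r / 2)) := by
  have h1 : L₁.jetOp r J t ((r + 1) / 2) (L.phase r J y t) = Ring.inverse (L₁.lead r t)
      (coord r ((r + 1) / 2) (L.phase r J y t)
        + L₁.sub₁ r J t (coord r ((r + 1) / 2 - 1) (L.phase r J y t))
        + L₁.sub₂ r t (coord r ((r + 1) / 2 - 2) (L.phase r J y t))) := by
    simp [jetOp]
  rw [h1, coord_phase_of_le h0 le_rfl (by omega), coord_phase_of_lt (by omega),
    coord_phase_of_lt (by omega), quasiDeriv_top_sub hr hodd ht,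
    quasiDeriv_top hL₁ hJ hy hr ht]
  have h2 : Ring.inverse (L₁.lead r t) (L₁.lead r t (jet J y t ((r + 1) / 2)))
      = jet J y t ((r + 1) / 2) := by
    rw [← ContinuousLinearMap.comp_apply, ← ContinuousLinearMap.mul_def,
      Ring.inverse_mul_cancel _ (isUnit_lead (hinv t ht))]
    rfl
  have h3 : ∀ A B C V : H, A - B - C + V + B + C = A + V := fun A B C V => by abel
  rw [h3, map_add, h2]

end Phase

lemma norm_sq_le_of_forall_coord_le {r : ℕ} {X : HilbPow H r} {ε : ℝ}
    (h : ∀ k : Fin r, ‖X k‖ ≤ ε) : ‖X‖ ^ 2 ≤ r * ε ^ 2 := by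
  rw [PiLp.norm_sq_eq_of_L2]
  calc ∑ k, ‖X k‖ ^ 2 ≤ ∑ _k : Fin r, ε ^ 2 :=
        Finset.sum_le_sum fun k _ => pow_le_pow_left₀ (norm_nonneg _) (h k) 2
    _ = r * ε ^ 2 := by simp

/-- Let the last rows of `L` and `L₁` agree if `r` is odd, and let the other rows differ by at most
`w` on the jet of a solution of `L[y] = 0`. Then the phase vector of this solution satisfies the
first order system of `L₁` up to an error of the size of `w`, and the operators `jetOp` of `L₁`
recover its derivatives up to an error of that size. -/
lemma exists_norm_phase_deriv_sub_le [CompleteSpace H] {L L₁ : DiffExpr H} {r : ℕ} {a b : ℝ}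
    (hab : a < b) (hr : 0 < r) (hL : L.SmoothOn r (Icc a b)) (hL₁ : L₁.SmoothOn r (Icc a b))
    (hinv : ∀ t ∈ Icc a b, L₁.LeadingInvertible r t)
    (hodd : ¬ Even r → ∀ t ∈ Icc a b, ∀ x,
      L.row r t x ((r + 1) / 2) = L₁.row r t x ((r + 1) / 2)) :
    ∃ C : ℝ, 0 ≤ C ∧ ∀ y : ℝ → H, ContDiffOn ℝ r y (Icc a b) →
      (∀ t ∈ Icc a b, L.apply r (Icc a b) y t = 0) →
      ∃ P' : ℝ → HilbPow H r,
        (∀ t ∈ Icc a b, HasDerivWithinAt (L.phase r (Icc a b) y) (P' t) (Icc a b) t) ∧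
        ∀ t ∈ Icc a b, ∀ w : ℝ,
          (∀ j, j ≤ (r + 1) / 2 → ‖L.row r t (jet (Icc a b) y t) j
            - L₁.row r t (jet (Icc a b) y t) j‖ ≤ w) →
          ‖P' t - L₁.systemOp r (Icc a b) t (L.phase r (Icc a b) y t)‖ ^ 2 ≤ C * w ^ 2 ∧
          ∀ k, k ≤ (r + 1) / 2 → ‖jet (Icc a b) y t k
            - L₁.jetOp r (Icc a b) t k (L.phase r (Icc a b) y t)‖ ^ 2 ≤ C * w ^ 2 := by
  set J := Icc a b with hJdef
  have hJ : UniqueDiffOn ℝ J := uniqueDiffOn_Icc hab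
  obtain ⟨C₁, hC₁0, hC₁⟩ := exists_norm_row_le hL₁
  obtain ⟨C₂', hC₂'⟩ := isCompact_Icc.exists_bound_of_continuousOn
    ((lead_contDiffOn hL₁).ringInverse fun t ht => isUnit_lead (hinv t ht)).continuousOn
  obtain ⟨C₂, hC₂0, hC₂⟩ : ∃ C₂ : ℝ, 0 ≤ C₂ ∧ ∀ t ∈ J, ‖Ring.inverse (L₁.lead r t)‖ ≤ C₂ :=
    ⟨|C₂'|, abs_nonneg _, fun t ht => (hC₂' t ht).trans (le_abs_self _)⟩
  refine ⟨r * (C₂ + 1 + C₁ * C₂) ^ 2, by positivity, fun y hy hsol => ?_⟩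
  have h0 : ∀ t ∈ J, L.quasiDeriv r J y r t = 0 := fun t ht => by
    rw [← apply_eq_quasiDeriv hL hJ hy hr ht]; exact hsol t ht
  refine ⟨_, fun t ht => hasDerivWithinAt_phase hL hJ hy hr ht, fun t ht w hw => ?_⟩
  have hw0 : 0 ≤ w := (norm_nonneg _).trans (hw 0 (Nat.zero_le _))
  set P := L.phase r J y t with hP
  have he : ∀ k, k ≤ (r + 1) / 2 →
      ‖jet J y t k - L₁.jetOp r J t k P‖ ≤ C₂ * w := by
    intro k hk
    rcases hk.lt_or_eq with hk | rfl
    · rw [jetOp_of_lt L₁ J t hk, coord_phase_of_lt hk, sub_self, norm_zero]; positivity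
    · rw [jetOp_phase_top hL₁ hJ hy hr hinv hodd ht (h0 t ht), sub_add_cancel_left, norm_neg]
      exact ((Ring.inverse (L₁.lead r t)).le_opNorm _).trans
        (mul_le_mul (hC₂ t ht) (hw _ (by omega)) (norm_nonneg _) hC₂0)
  have hfin : ∀ z : ℝ, 0 ≤ z → z ≤ (C₂ + 1 + C₁ * C₂) * w →
      r * z ^ 2 ≤ r * (C₂ + 1 + C₁ * C₂) ^ 2 * w ^ 2 := fun z hz hzw => by
    rw [mul_assoc, ← mul_pow]
    exact mul_le_mul_of_nonneg_left (pow_le_pow_left₀ hz hzw 2) (by positivity)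
  constructor
  · refine (norm_sq_le_of_forall_coord_le (ε := (C₂ + 1 + C₁ * C₂) * w) fun k => ?_).trans
      (hfin _ (by positivity) le_rfl)
    rw [PiLp.sub_apply, systemOp_apply, systemRow]
    simp only
    split_ifs with hk
    · refine (he _ hk).trans ?_
      nlinarith [mul_nonneg (mul_nonneg hC₁0 hC₂0) hw0]
    · have hk := not_lt.1 hk
      rw [sub_apply, rowOp_apply, coord_phase_of_le (h0 t ht) (by omega) k.2]
      have e : ∀ A B C D : H, A - B - (C - B) = (A - D) + (D - C) := fun A B C D => by abel
      rw [e _ _ _ (L₁.row r t (jet J y t) (r - (k + 1))), ← row_sub]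
      refine (norm_add_le _ _).trans ?_
      have h1 := hw (r - (k + 1)) (by omega)
      have h2 := hC₁ t ht (r - (k + 1)) (by omega)
        (fun i => jet J y t i - L₁.jetOp r J t i P) (C₂ * w) (by positivity) he
      nlinarith [mul_nonneg hC₂0 hw0]
  · intro k hk
    have h1 : (1 : ℝ) ≤ r := by exact_mod_cast hr
    have h2 := hfin _ (norm_nonneg _) ((he k hk).trans (by
      nlinarith [mul_nonneg (mul_nonneg hC₁0 hC₂0) hw0]))
    refine le_trans ?_ h2
    nlinarith [sq_nonneg ‖jet J y t k - L₁.jetOp r J t k P‖]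

end DiffExpr

end

/-! ### Stability of the definiteness condition -/

noncomputable section

namespace DiffExpr

variable {H : Type*} [NormedAddCommGroup H] [InnerProductSpace ℂ H]

lemma exists_vecForm_re_le {L : DiffExpr H} {r : ℕ} {a b : ℝ} (hL : L.SmoothOn r (Icc a b)) :
    ∃ C : ℝ, 0 ≤ C ∧ ∀ t ∈ Icc a b, ∀ (x : ℕ → H) (ε : ℝ), 0 ≤ ε →
      (∀ i, i ≤ (r + 1) / 2 → ‖x i‖ ≤ ε) → (L.vecForm r t x x).re ≤ C * ε ^ 2 := by
  obtain ⟨C, hC0, hC⟩ := exists_norm_row_le hL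
  refine ⟨((r + 1) / 2 + 1 : ℕ) * C, by positivity, fun t ht x ε hε hx => ?_⟩
  rw [vecForm_eq_sum_row, Complex.re_sum]
  calc ∑ j ∈ Finset.range ((r + 1) / 2 + 1), (inner ℂ (x j) (L.row r t x j)).re
      ≤ ∑ _j ∈ Finset.range ((r + 1) / 2 + 1), ε * (C * ε) := by
        refine Finset.sum_le_sum fun j hj => ?_
        have hj' : j ≤ (r + 1) / 2 := Nat.lt_succ_iff.1 (Finset.mem_range.1 hj)
        exact ((Complex.re_le_norm _).trans (norm_inner_le_norm _ _)).trans
          (mul_le_mul (hx j hj') (hC t ht j hj' x ε hε hx) (norm_nonneg _) hε)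
    _ = ((r + 1) / 2 + 1 : ℕ) * C * ε ^ 2 := by
        rw [Finset.sum_const, Finset.card_range, nsmul_eq_mul]; ring

variable [CompleteSpace H]

lemma exists_norm_jetOp_le {L : DiffExpr H} {r : ℕ} {a b : ℝ} (hab : a < b) (hr : 0 < r)
    (hL : L.SmoothOn r (Icc a b)) (hinv : ∀ t ∈ Icc a b, L.LeadingInvertible r t) :
    ∃ C : ℝ, ∀ t ∈ Icc a b, ∀ k, k ≤ (r + 1) / 2 → ‖L.jetOp r (Icc a b) t k‖ ≤ C := by
  have hb : ∀ k, ∃ C, ∀ t ∈ Icc a b, ‖L.jetOp r (Icc a b) t k‖ ≤ C := fun k =>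
    isCompact_Icc.exists_bound_of_continuousOn (E := HilbPow H r →L[ℂ] H)
      (f := fun t => L.jetOp r (Icc a b) t k)
      (jetOp_continuousOn hL (uniqueDiffOn_Icc hab) hr hinv k)
  choose C hC using hb
  refine ⟨∑ k ∈ Finset.range ((r + 1) / 2 + 1), |C k|, fun t ht k hk => ?_⟩
  exact ((hC k t ht).trans (le_abs_self _)).trans
    (Finset.single_le_sum (f := fun k => |C k|) (fun _ _ => abs_nonneg _)
      (Finset.mem_range.2 (by omega)))

/-- Let `m ≤ K` be nonnegative symmetric expressions and let `L - L₁` be a linear combination of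
them. If the integral of `m{y, y}` is definite on the solutions of `L₁[y] = 0`, then the integral of
`K{y, y}` is definite on the solutions of `L[y] = 0`: solutions of the two equations with a common
phase vector at `0` stay close to each other in terms of the integral of `K{y, y}`. -/
theorem exists_norm_phase_sq_le_integral {L L₁ K m : DiffExpr H} {r : ℕ} {a b α β δ : ℝ} {c₁ c₂ : ℂ}
    (hab : a < b) (hr : 0 < r) (hα : α ∈ Icc a b) (hβ : β ∈ Icc a b) (hα0 : α ≤ 0) (hβ0 : 0 ≤ β)
    (hL : L.SmoothOn r (Icc a b)) (hL₁ : L₁.SmoothOn r (Icc a b))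
    (hK : K.SmoothOn r (Icc a b)) (hm : m.SmoothOn r (Icc a b))
    (hinv : ∀ t ∈ Icc a b, L₁.LeadingInvertible r t)
    (hKs : K.EqOn K.adj r (Icc a b)) (hms : m.EqOn m.adj r (Icc a b))
    (hm0 : ∀ t ∈ Icc a b, ∀ x : ℕ → H, 0 ≤ (m.vecForm r t x x).re)
    (hmK : ∀ t ∈ Icc a b, ∀ x : ℕ → H, (m.vecForm r t x x).re ≤ (K.vecForm r t x x).re)
    (hLL : ∀ t ∈ Icc a b, ∀ (x : ℕ → H) (j : ℕ),
      L.row r t x j - L₁.row r t x j = c₁ • K.row r t x j + c₂ • m.row r t x j)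
    (hδ : 0 < δ)
    (hdef : ∀ y : ℝ → H, ContDiffOn ℝ r y (Icc a b) →
      (∀ t ∈ Icc a b, L₁.apply r (Icc a b) y t = 0) →
      δ * ‖L₁.phase r (Icc a b) y 0‖ ^ 2 ≤ ∫ t in α..β, (m.form r (Icc a b) y y t).re) :
    ∃ δ' > (0 : ℝ), ∀ y : ℝ → H, ContDiffOn ℝ r y (Icc a b) →
      (∀ t ∈ Icc a b, L.apply r (Icc a b) y t = 0) →
      δ' * ‖L.phase r (Icc a b) y 0‖ ^ 2 ≤ ∫ t in α..β, (K.form r (Icc a b) y y t).re := by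
  set J := Icc a b with hJdef
  have hJ : UniqueDiffOn ℝ J := uniqueDiffOn_Icc hab
  have h0J : (0 : ℝ) ∈ J := ⟨hα.1.trans hα0, hβ0.trans hβ.2⟩
  have hK0 : ∀ t ∈ J, ∀ x : ℕ → H, 0 ≤ (K.vecForm r t x x).re := fun t ht x =>
    (hm0 t ht x).trans (hmK t ht x)
  have hodd : ¬ Even r → ∀ t ∈ J, ∀ x,
      L.row r t x ((r + 1) / 2) = L₁.row r t x ((r + 1) / 2) := fun he t ht x => by
    rw [← sub_eq_zero, hLL t ht, row_top_eq_zero he hKs ht (hK0 t ht),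
      row_top_eq_zero he hms ht (hm0 t ht)]
    simp
  obtain ⟨CK, hCK0, hCK⟩ := exists_norm_p_le hK
  obtain ⟨Cm, hCm0, hCm⟩ := exists_norm_p_le hm
  obtain ⟨CL, hCL0, hCL⟩ := exists_norm_phase_deriv_sub_le hab hr hL hL₁ hinv hodd
  obtain ⟨CL', -, hCL'⟩ := exists_norm_phase_deriv_sub_le hab hr hL₁ hL₁ hinv (fun _ _ _ _ => rfl)
  obtain ⟨CA, hCA⟩ := isCompact_Icc.exists_bound_of_continuousOn
    (systemOp_continuousOn hL₁ hJ hr hinv)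
  obtain ⟨CJ, hCJ⟩ := exists_norm_jetOp_le hab hr hL₁ hinv
  obtain ⟨Cf, hCf0, hCf⟩ := exists_vecForm_re_le hm
  set C₀ : ℝ := 2 * ‖c₁‖ ^ 2 * CK + 2 * ‖c₂‖ ^ 2 * Cm with hC₀
  have hC₀0 : 0 ≤ C₀ := by positivity
  set G : ℝ := Real.exp ((2 * CA ^ 2 + 1) * (b - a)) * (2 * CL * C₀) with hG
  have hG0 : 0 ≤ G := by positivity
  have hαβ : α ≤ β := hα0.trans hβ0
  have hsub : Icc α β ⊆ J := Icc_subset_Icc hα.1 hβ.2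
  set Ct : ℝ := 2 + 4 * Cf * (CL * C₀) + 4 * Cf * CJ ^ 2 * G * (β - α) with hCt
  have hCt0 : 0 < Ct := by
    have : 0 ≤ β - α := sub_nonneg.2 hαβ
    positivity
  refine ⟨δ / Ct, div_pos hδ hCt0, fun y hy hsol => ?_⟩
  obtain ⟨y₁, hy₁, hsol₁, hP0⟩ := exists_solution_phase_eq hab h0J hr hL₁ hinv (L.phase r J y 0)
  obtain ⟨P', hP', hPb⟩ := hCL y hy hsol
  obtain ⟨P₁', hP₁', hP₁b⟩ := hCL' y₁ hy₁ hsol₁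
  set k : ℝ → ℝ := fun t => (K.form r J y y t).re with hk
  have hkc : ContinuousOn k J :=
    Complex.continuous_re.comp_continuousOn (form_continuousOn hab hK hy)
  have hk0 : ∀ t ∈ J, 0 ≤ k t := fun t ht => hK0 t ht _
  set E : ℝ := ∫ t in α..β, k t with hE
  have hE0 : 0 ≤ E := intervalIntegral.integral_nonneg hαβ fun t ht => hk0 t (hsub ht)
  -- the rows of `L - L₁` on the jet of `y` are of size `√k`
  have hw : ∀ t ∈ J, ∀ j, j ≤ (r + 1) / 2 →
      ‖L.row r t (jet J y t) j - L₁.row r t (jet J y t) j‖ ≤ √(C₀ * k t) := by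
    intro t ht j hj
    refine Real.le_sqrt_of_sq_le ?_
    have h1 : ‖K.row r t (jet J y t) j‖ ^ 2 ≤ CK * k t :=
      norm_row_sq_le hKs ht (hK0 t ht) hj hCK0 (hCK t ht j) _
    have h2 : ‖m.row r t (jet J y t) j‖ ^ 2 ≤ Cm * k t :=
      (norm_row_sq_le hms ht (hm0 t ht) hj hCm0 (hCm t ht j) _).trans
        (mul_le_mul_of_nonneg_left (hmK t ht _) hCm0.le)
    have h3 : ‖L.row r t (jet J y t) j - L₁.row r t (jet J y t) j‖ ≤
        ‖c₁‖ * ‖K.row r t (jet J y t) j‖ + ‖c₂‖ * ‖m.row r t (jet J y t) j‖ := by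
      rw [hLL t ht, ← norm_smul, ← norm_smul]; exact norm_add_le _ _
    have h4 := pow_le_pow_left₀ (norm_nonneg _) h3 2
    have h5 := mul_le_mul_of_nonneg_left h1 (sq_nonneg ‖c₁‖)
    have h6 := mul_le_mul_of_nonneg_left h2 (sq_nonneg ‖c₂‖)
    have h7 := add_sq_le (a := ‖c₁‖ * ‖K.row r t (jet J y t) j‖)
      (b := ‖c₂‖ * ‖m.row r t (jet J y t) j‖)
    rw [mul_pow, mul_pow] at h7
    calc _ ≤ _ := h4.trans h7
      _ ≤ 2 * (‖c₁‖ ^ 2 * (CK * k t) + ‖c₂‖ ^ 2 * (Cm * k t)) := by linarith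
      _ = C₀ * k t := by rw [hC₀]; ring
  have hwsq : ∀ t ∈ J, √(C₀ * k t) ^ 2 = C₀ * k t := fun t ht =>
    Real.sq_sqrt (mul_nonneg hC₀0 (hk0 t ht))
  have hP₁ : ∀ t ∈ J, P₁' t = L₁.systemOp r J t (L₁.phase r J y₁ t) ∧
      ∀ i, i ≤ (r + 1) / 2 → jet J y₁ t i = L₁.jetOp r J t i (L₁.phase r J y₁ t) := by
    intro t ht
    obtain ⟨h1, h2⟩ := hP₁b t ht 0 (fun j _ => by simp)
    have hz : ∀ z : ℝ, z ^ 2 ≤ CL' * 0 ^ 2 → z = 0 := fun z hz =>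
      pow_eq_zero_iff two_ne_zero |>.1 (le_antisymm (by simpa using hz) (sq_nonneg z))
    exact ⟨sub_eq_zero.1 (norm_eq_zero.1 (hz _ h1)),
      fun i hi => sub_eq_zero.1 (norm_eq_zero.1 (hz _ (h2 i hi)))⟩
  -- the energy estimate for the difference of the phase vectors
  set d : ℝ → HilbPow H r := fun t => L.phase r J y t - L₁.phase r J y₁ t with hd
  have hdE : ∀ t ∈ Icc α β, ‖d t‖ ^ 2 ≤ G * E := by
    intro t ht
    have h := norm_sq_le_of_norm_deriv_sq_le (d := d) (d' := fun t => P' t - P₁' t)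
      (κ := fun t => 2 * CL * C₀ * k t) (C := 2 * CA ^ 2) (by positivity) hα hβ hα0 hβ0
      (fun t ht => (hP' t ht).sub (hP₁' t ht)) (continuousOn_const.mul hkc)
      (fun t ht => mul_nonneg (by positivity) (hk0 t ht)) (fun t ht => by
        obtain ⟨h1, -⟩ := hPb t ht _ (hw t ht)
        rw [hwsq t ht] at h1
        have h2 : P' t - P₁' t = L₁.systemOp r J t (d t)
            + (P' t - L₁.systemOp r J t (L.phase r J y t)) := by
          rw [(hP₁ t ht).1, hd, map_sub]; abel
        have h3 : ‖L₁.systemOp r J t (d t)‖ ^ 2 ≤ CA ^ 2 * ‖d t‖ ^ 2 := by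
          rw [← mul_pow]
          exact pow_le_pow_left₀ (norm_nonneg _) (((L₁.systemOp r J t).le_opNorm _).trans
            (mul_le_mul_of_nonneg_right (hCA t ht) (norm_nonneg _))) 2
        have h4 := pow_le_pow_left₀ (norm_nonneg _) (norm_add_le (L₁.systemOp r J t (d t))
          (P' t - L₁.systemOp r J t (L.phase r J y t))) 2
        rw [h2]
        have h5 := h4.trans add_sq_le
        linarith) t ht
    have hd0 : d 0 = 0 := by rw [hd]; simp only; rw [hP0, sub_self]
    rw [hd0, norm_zero, intervalIntegral.integral_const_mul] at h
    refine h.trans (le_of_eq ?_)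
    rw [hG, hE]; ring
  have hpt : ∀ t ∈ Icc α β, (m.form r J y₁ y₁ t).re ≤
      (2 + 4 * Cf * (CL * C₀)) * k t + 4 * Cf * CJ ^ 2 * (G * E) := by
    intro t ht
    have htJ := hsub ht
    have hkt := hk0 t htJ
    have hε : ∀ i, i ≤ (r + 1) / 2 → ‖jet J y t i - jet J y₁ t i‖ ≤
        √(2 * (CL * (C₀ * k t)) + 2 * (CJ ^ 2 * (G * E))) := by
      intro i hi
      refine Real.le_sqrt_of_sq_le ?_
      have h1 := (hPb t htJ _ (hw t htJ)).2 i hi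
      rw [hwsq t htJ] at h1
      have h2 : jet J y t i - jet J y₁ t i =
          (jet J y t i - L₁.jetOp r J t i (L.phase r J y t)) + L₁.jetOp r J t i (d t) := by
        rw [(hP₁ t htJ).2 i hi, hd, map_sub]; abel
      have h3 : ‖L₁.jetOp r J t i (d t)‖ ^ 2 ≤ CJ ^ 2 * (G * E) := by
        refine le_trans ?_ (mul_le_mul_of_nonneg_left (hdE t ht) (sq_nonneg CJ))
        rw [← mul_pow]
        exact pow_le_pow_left₀ (norm_nonneg _) (((L₁.jetOp r J t i).le_opNorm _).trans
          (mul_le_mul_of_nonneg_right (hCJ t htJ i hi) (norm_nonneg _))) 2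
      have h4 := pow_le_pow_left₀ (norm_nonneg _) (norm_add_le
        (jet J y t i - L₁.jetOp r J t i (L.phase r J y t)) (L₁.jetOp r J t i (d t))) 2
      rw [h2]
      have h5 := h4.trans add_sq_le
      linarith
    have h1 := hCf t htJ (fun i => jet J y t i - jet J y₁ t i) _ (Real.sqrt_nonneg _) hε
    rw [Real.sq_sqrt (by positivity)] at h1
    have h2 := vecForm_re_le_of_nonneg (hm0 t htJ) (jet J y t) (jet J y₁ t)
    have h3 : (m.vecForm r t (jet J y t) (jet J y t)).re ≤ k t := hmK t htJ _
    have h4 : (m.form r J y₁ y₁ t).re = (m.vecForm r t (jet J y₁ t) (jet J y₁ t)).re := rfl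
    rw [h4]
    linarith
  have huI : uIcc α β ⊆ J := by rwa [uIcc_of_le hαβ]
  have hint : ∫ t in α..β, (m.form r J y₁ y₁ t).re ≤ Ct * E := by
    have hki : IntervalIntegrable k MeasureTheory.volume α β :=
      (hkc.mono huI).intervalIntegrable
    have h1 := intervalIntegral.integral_mono_on hαβ
      (((Complex.continuous_re.comp_continuousOn
        (form_continuousOn hab hm hy₁)).mono huI).intervalIntegrable)
      ((hki.const_mul (2 + 4 * Cf * (CL * C₀))).add
        (intervalIntegrable_const (c := 4 * Cf * CJ ^ 2 * (G * E)))) hpt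
    rw [intervalIntegral.integral_add (hki.const_mul _) intervalIntegrable_const,
      intervalIntegral.integral_const_mul, intervalIntegral.integral_const, smul_eq_mul] at h1
    refine h1.trans (le_of_eq ?_)
    rw [hCt, ← hE]; ring
  have hfin := (hdef y₁ hy₁ hsol₁).trans hint
  rw [hP0] at hfin
  rw [div_mul_eq_mul_div, div_le_iff₀ hCt0, mul_comm E]
  exact hfin

end DiffExpr

end

/-! ### The boundary vector -/

noncomputable section

namespace DiffExpr

variable {H : Type*} [NormedAddCommGroup H] [InnerProductSpace ℂ H]

lemma quasiDeriv_zero (L : DiffExpr H) (r : ℕ) (J : Set ℝ) (k : ℕ) :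
    L.quasiDeriv r J (0 : ℝ → H) k = 0 := by
  have hi : ∀ i t, iteratedDerivWithin i (0 : ℝ → H) J t = 0 := fun _ _ =>
    iteratedDerivWithin_const_zero
  have hd : ∀ t, derivWithin (0 : ℝ → H) J t = 0 := fun t => by
    rw [← iteratedDerivWithin_one]; exact hi 1 t
  have hmid : ∀ t, quasiDeriv.mid L r J (0 : ℝ → H) t = 0 := fun t => by
    simp [quasiDeriv.mid, quasiDeriv.qterm, hi]
  induction k with
  | zero => funext t; simp [quasiDeriv, hmid]
  | succ k ih =>
    funext t
    simp [quasiDeriv, hmid, ih, quasiDeriv.qterm, hi, hd]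

section VecPhase

variable {L m : DiffExpr H} {r s : ℕ} {J : Set ℝ} {y : ℝ → H}

lemma norm_vec_zero_sq_le (hr : 0 < r) (t : ℝ) :
    ‖L.vec m r s J y 0 t‖ ^ 2 ≤ r * ‖L.phase r J y t‖ ^ 2 := by
  refine norm_sq_le_of_forall_coord_le fun k => ?_
  have hc : ∀ i (hi : i < r), ‖L.phase r J y t ⟨i, hi⟩‖ ≤ ‖L.phase r J y t‖ := fun i hi =>
    PiLp.norm_apply_le _ _
  have hk := k.2
  simp only [vec, quasiDeriv_zero, Pi.zero_apply, ite_self, sub_zero]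
  split_ifs with h1 h2 h3
  · refine le_trans (le_of_eq ?_) (hc 0 hr)
    simp [phase, h1, jet]
  · refine le_trans (le_of_eq ?_) (hc k (by omega))
    simp [phase, jet, show (k : ℕ) < (r + 1) / 2 by omega]
  · refine le_trans (le_of_eq ?_) (hc (r - (k - r / 2 + 1)) (by omega))
    simp [phase, show ¬ r - (k - r / 2 + 1) < (r + 1) / 2 by omega]
  · refine le_trans (le_of_eq ?_) (hc (r / 2) (by omega))
    simp [phase, jet, show r / 2 < (r + 1) / 2 by omega, norm_smul]

lemma norm_phase_sq_le (t : ℝ) :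
    ‖L.phase r J y t‖ ^ 2 ≤ r * ‖L.vec m r s J y 0 t‖ ^ 2 := by
  refine norm_sq_le_of_forall_coord_le fun k => ?_
  have hc : ∀ i (hi : i < r), ‖L.vec m r s J y 0 t ⟨i, hi⟩‖ ≤ ‖L.vec m r s J y 0 t‖ := fun i hi =>
    PiLp.norm_apply_le _ _
  have hk := k.2
  simp only [vec, quasiDeriv_zero, Pi.zero_apply, ite_self, sub_zero] at hc ⊢
  by_cases h1 : r = 1
  · refine le_trans (le_of_eq ?_) (hc 0 (by omega))
    have : (k : ℕ) = 0 := by omega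
    simp [phase, h1, this, jet]
  · by_cases h2 : (k : ℕ) < r / 2
    · refine le_trans (le_of_eq ?_) (hc k hk)
      simp [phase, h1, h2, jet, show (k : ℕ) < (r + 1) / 2 by omega]
    · by_cases h3 : (k : ℕ) < (r + 1) / 2
      · refine le_trans (le_of_eq ?_) (hc (2 * (r / 2)) (by omega))
        have h4 : (k : ℕ) = r / 2 := by omega
        simp [phase, h1, jet, show ¬ 2 * (r / 2) < r / 2 by omega, h4, norm_smul,
          show r / 2 < (r + 1) / 2 by omega]
      · refine le_trans (le_of_eq ?_) (hc (r / 2 + (r - (k + 1))) (by omega))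
        simp [phase, h1, h3, show r / 2 + (r - (k + 1)) < 2 * (r / 2) by omega,
          show r - (r - (↑k + 1) + 1) = (k : ℕ) by omega]

lemma vec_continuousOn (hJ : UniqueDiffOn ℝ J) (hr : 0 < r) (hL : L.SmoothOn r J)
    (hm : m.SmoothOn s J) (hs : Even s) (hy : ContDiffOn ℝ r y J) {f : ℝ → H}
    (hf : ContDiffOn ℝ s f J) : ContinuousOn (L.vec m r s J y f) J := by
  refine (PiLp.continuous_toLp 2 _).comp_continuousOn (continuousOn_pi.2 fun k => ?_)
  have hk := k.2
  split_ifs with h1 h2 h3 h4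
  · exact hy.continuousOn
  · exact (jet_contDiffOn (e := 0) hJ hy (k := k) (by omega)).continuousOn
  · refine (quasiDeriv_contDiffOn hL hJ hy hr (by omega) (by omega)).continuousOn.sub ?_
    obtain ⟨i, rfl⟩ := hs
    exact (quasiDeriv_contDiffOn hm hJ hf (by omega) (by omega) (by omega)).continuousOn
  · exact (quasiDeriv_contDiffOn hL hJ hy hr (by omega) (by omega)).continuousOn.sub
      continuousOn_const
  · exact (ContinuousOn.fun_smul continuousOn_const
      (jet_contDiffOn (e := 0) hJ hy (k := r / 2) (by omega)).continuousOn).neg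

lemma continuousOn_inner_reQ [CompleteSpace H] (hL : L.SmoothOn r J) {v : ℝ → HilbPow H r}
    (hv : ContinuousOn v J) :
    ContinuousOn (fun t => (inner ℂ (v t) (L.reQ r t (v t))).re) J := by
  have h1 : ∀ t, (inner ℂ (v t) (L.reQ r t (v t))).re = (inner ℂ (v t) (L.Q r t (v t))).re := by
    intro t
    have h2 : inner ℂ (v t) (ContinuousLinearMap.adjoint (L.Q r t) (v t)) =
        conj (inner ℂ (v t) (L.Q r t (v t))) := by
      rw [ContinuousLinearMap.adjoint_inner_right, inner_conj_symm]
    simp only [reQ, smul_apply, add_apply, inner_smul_right, inner_add_right, h2,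
      Complex.add_conj]
    rw [← Complex.ofReal_ofNat]
    simp
  have hvk : ∀ k, ContinuousOn (fun t => v t k) J := fun k =>
    (PiLp.continuous_apply 2 _ k).comp_continuousOn hv
  simp only [h1]
  refine Complex.continuous_re.comp_continuousOn (hv.inner ?_)
  refine (PiLp.continuous_toLp 2 (fun _ : Fin r => H)).comp_continuousOn
    (continuousOn_pi.2 fun k => ?_)
  have hk := k.2
  by_cases h3 : (k : ℕ) < r / 2
  · simpa [h3] using ContinuousOn.fun_smul (continuousOn_const (c := Complex.I))
      (hvk ⟨k + r / 2, by omega⟩)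
  · by_cases h4 : (k : ℕ) < 2 * (r / 2)
    · simpa [h3, h4] using ContinuousOn.fun_smul (continuousOn_const (c := -Complex.I))
        (hvk ⟨k - r / 2, by omega⟩)
    · simpa [h3, h4] using
        (hL.2 (r / 2 + 1) (by omega) (by omega)).1.continuousOn.clm_apply (hvk k)

end VecPhase

/-! ### Linear combinations of expressions -/

section Combination

lemma row_of_eq_combination {A B C : DiffExpr H} {r : ℕ} {t : ℝ} {c₁ c₂ : ℂ}
    (hp : ∀ j, 2 * j ≤ r → A.p j t = c₁ • B.p j t + c₂ • C.p j t)
    (hqs : ∀ j, 1 ≤ j → 2 * j ≤ r + 1 → A.q j t = c₁ • B.q j t + c₂ • C.q j t ∧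
      A.s j t = c₁ • B.s j t + c₂ • C.s j t) (x : ℕ → H) (j : ℕ) :
    A.row r t x j = c₁ • B.row r t x j + c₂ • C.row r t x j := by
  have h1 : (if 2 * j ≤ r then A.p j t (x j) else 0) =
      c₁ • (if 2 * j ≤ r then B.p j t (x j) else 0)
        + c₂ • (if 2 * j ≤ r then C.p j t (x j) else 0) := by
    split_ifs with h
    · rw [hp j h]; rfl
    · simp
  have h2 : (if 2 * j + 1 ≤ r then A.s (j + 1) t (x (j + 1)) else 0) =
      c₁ • (if 2 * j + 1 ≤ r then B.s (j + 1) t (x (j + 1)) else 0)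
        + c₂ • (if 2 * j + 1 ≤ r then C.s (j + 1) t (x (j + 1)) else 0) := by
    split_ifs with h
    · rw [(hqs (j + 1) (by omega) (by omega)).2]; rfl
    · simp
  have h3 : (if j ≠ 0 ∧ 2 * j ≤ r + 1 then A.q j t (x (j - 1)) else 0) =
      c₁ • (if j ≠ 0 ∧ 2 * j ≤ r + 1 then B.q j t (x (j - 1)) else 0)
        + c₂ • (if j ≠ 0 ∧ 2 * j ≤ r + 1 then C.q j t (x (j - 1)) else 0) := by
    split_ifs with h
    · rw [(hqs j (by omega) (by omega)).1]; rfl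
    · simp
  rw [row, h1, h2, h3, row, row]
  module

lemma vecForm_of_row {A B C : DiffExpr H} {r : ℕ} {t : ℝ} {c₁ c₂ : ℂ}
    (h : ∀ x j, A.row r t x j = c₁ • B.row r t x j + c₂ • C.row r t x j) (x g : ℕ → H) :
    A.vecForm r t x g = c₁ * B.vecForm r t x g + c₂ * C.vecForm r t x g := by
  simp only [vecForm_eq_sum_row, h, inner_add_right, inner_smul_right, Finset.sum_add_distrib,
    Finset.mul_sum]

lemma SmoothOn.congr {A B : DiffExpr H} {r : ℕ} {J : Set ℝ} (hB : B.SmoothOn r J)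
    (h : A.EqOn B r J) : A.SmoothOn r J :=
  ⟨fun j hj => (hB.1 j hj).congr fun t ht => (h t ht).1 j hj,
    fun j h1 hj => ⟨(hB.2 j h1 hj).1.congr fun t ht => ((h t ht).2 j h1 hj).1,
      (hB.2 j h1 hj).2.congr fun t ht => ((h t ht).2 j h1 hj).2⟩⟩

lemma SmoothOn.combination {A B C : DiffExpr H} {r : ℕ} {J : Set ℝ} {c₁ c₂ : ℂ}
    (hB : B.SmoothOn r J) (hC : C.SmoothOn r J)
    (h : ∀ t ∈ J, (∀ j, 2 * j ≤ r → A.p j t = c₁ • B.p j t + c₂ • C.p j t) ∧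
      (∀ j, 1 ≤ j → 2 * j ≤ r + 1 → A.q j t = c₁ • B.q j t + c₂ • C.q j t ∧
      A.s j t = c₁ • B.s j t + c₂ • C.s j t)) : A.SmoothOn r J :=
  ⟨fun j hj => (((hB.1 j hj).const_smul c₁).add ((hC.1 j hj).const_smul c₂)).congr
      fun t ht => (h t ht).1 j hj,
    fun j h1 hj => ⟨(((hB.2 j h1 hj).1.const_smul c₁).add ((hC.2 j h1 hj).1.const_smul c₂)).congr
        fun t ht => ((h t ht).2 j h1 hj).1,
      (((hB.2 j h1 hj).2.const_smul c₁).add ((hC.2 j h1 hj).2.const_smul c₂)).congr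
        fun t ht => ((h t ht).2 j h1 hj).2⟩⟩

variable {m : DiffExpr H} {r s : ℕ} {J : Set ℝ}

lemma SmoothOn.of_orderLE (hm : m.SmoothOn s J) (ho : m.OrderLE s J) : m.SmoothOn r J := by
  refine ⟨fun j _ => ?_, fun j h1 _ => ?_⟩
  · by_cases h : 2 * j ≤ s
    · exact hm.1 j h
    · exact (contDiffOn_const (c := 0)).congr fun t ht => (ho t ht).1 j (by omega)
  · by_cases h : 2 * j ≤ s + 1
    · exact hm.2 j h1 h
    · exact ⟨(contDiffOn_const (c := 0)).congr fun t ht => ((ho t ht).2 j (by omega)).1,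
        (contDiffOn_const (c := 0)).congr fun t ht => ((ho t ht).2 j (by omega)).2⟩

lemma vecForm_of_orderLE (ho : m.OrderLE s J) (hsr : s ≤ r) {t : ℝ} (ht : t ∈ J) (x g : ℕ → H) :
    m.vecForm s t x g = m.vecForm r t x g := by
  unfold vecForm
  congr 1
  · refine Finset.sum_subset (Finset.range_subset_range.2 (by omega)) fun j _ hj => ?_
    have : s < 2 * j := by have := mt Finset.mem_range.2 hj; omega
    rw [(ho t ht).1 j this]; simp
  · congr 1
    refine Finset.sum_subset (Finset.Icc_subset_Icc le_rfl (by omega)) fun j hj hj' => ?_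
    have h1 := Finset.mem_Icc.1 hj
    have : s + 1 < 2 * j := by have := mt Finset.mem_Icc.2 hj'; omega
    rw [((ho t ht).2 j this).1, ((ho t ht).2 j this).2]; simp

variable [CompleteSpace H]

lemma EqOn.adj_of_orderLE (hm : m.EqOn m.adj s J) (ho : m.OrderLE s J) : m.EqOn m.adj r J := by
  refine fun t ht => ⟨fun j _ => ?_, fun j h1 _ => ?_⟩
  · by_cases h : 2 * j ≤ s
    · exact (hm t ht).1 j h
    · simp [adj, (ho t ht).1 j (by omega)]
  · by_cases h : 2 * j ≤ s + 1
    · exact (hm t ht).2 j h1 h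
    · simp [adj, (ho t ht).2 j (by omega)]

lemma EqOn.adj_of_eqOn_re {l L : DiffExpr H} (hl : l.EqOn L.re r J) : l.EqOn l.adj r J := by
  refine fun t ht => ⟨fun j hj => ?_, fun j h1 hj => ?_⟩
  · simp only [adj, (hl t ht).1 j hj, re, map_smulₛₗ, map_add,
      ContinuousLinearMap.adjoint_adjoint]
    simp [add_comm, map_ofNat]
  · simp only [adj, ((hl t ht).2 j h1 hj).1, ((hl t ht).2 j h1 hj).2, re, map_smulₛₗ, map_add,
      ContinuousLinearMap.adjoint_adjoint]
    simp [add_comm, map_ofNat]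

/-- For symmetric `l` and `m` the expression `Im (l - z m) / Im z` is `-m`, also for real `z`, where
it stands for the derivative in `z`. -/
lemma imQuot_pencil_zero {l : DiffExpr H} (hl : l.EqOn l.adj r J) (hm : m.EqOn m.adj r J) (z : ℂ)
    {t : ℝ} (ht : t ∈ J) :
    (∀ j, 2 * j ≤ r → (imQuot (pencil l m 0) z).p j t = -m.p j t) ∧
      ∀ j, 1 ≤ j → 2 * j ≤ r + 1 → (imQuot (pencil l m 0) z).q j t = -m.q j t ∧
        (imQuot (pencil l m 0) z).s j t = -m.s j t := by
  by_cases hz : z.im = 0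
  · have hd : ∀ A C : H →L[ℂ] H, deriv (fun w : ℂ => A - w • C - 0) z = -C := fun A C => by
      have h := (((hasDerivAt_id z).smul_const C).const_sub A).sub_const 0
      simpa using h.deriv
    simp only [imQuot, hz, if_true, paramDeriv, pencil]
    exact ⟨fun j _ => hd _ _, fun j _ _ => ⟨hd _ _, hd _ _⟩⟩
  · have hne : (2 * Complex.I * z.im : ℂ) ≠ 0 := by simp [hz]
    have hd : ∀ A A' C C' : H →L[ℂ] H, A = ContinuousLinearMap.adjoint A' →
        C = ContinuousLinearMap.adjoint C' → (1 / (2 * Complex.I * z.im) : ℂ) •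
          ((A - z • C - 0) - ContinuousLinearMap.adjoint (A' - z • C' - 0)) = -C := by
      intro A A' C C' hA hC
      simp only [sub_zero, map_sub, map_smulₛₗ, ← hA, ← hC]
      have e : A - z • C - (A - conj z • C) = (-(2 * Complex.I * z.im) : ℂ) • C := by
        have : z - conj z = 2 * Complex.I * z.im := by
          rw [Complex.sub_conj]; push_cast; ring
        rw [← this]; module
      rw [e, smul_smul, mul_neg, one_div, inv_mul_cancel₀ hne, neg_one_smul]
    simp only [imQuot, hz, if_false, pencil, adj]
    exact ⟨fun j hj => hd _ _ _ _ ((hl t ht).1 j hj) ((hm t ht).1 j hj), fun j h1 hj =>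
      ⟨hd _ _ _ _ ((hl t ht).2 j h1 hj).1 ((hm t ht).2 j h1 hj).1,
        hd _ _ _ _ ((hl t ht).2 j h1 hj).2 ((hm t ht).2 j h1 hj).2⟩⟩

/-- The expression `-Im L = (i/2) (L - L^*)`. -/
def negIm (L : DiffExpr H) : DiffExpr H where
  p j t := (Complex.I / 2) • L.p j t + (-(Complex.I / 2)) • L.adj.p j t
  q j t := (Complex.I / 2) • L.q j t + (-(Complex.I / 2)) • L.adj.q j t
  s j t := (Complex.I / 2) • L.s j t + (-(Complex.I / 2)) • L.adj.s j t

lemma row_negIm (L : DiffExpr H) (r : ℕ) (t : ℝ) (x : ℕ → H) (j : ℕ) :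
    L.negIm.row r t x j =
      (Complex.I / 2) • L.row r t x j + (-(Complex.I / 2)) • L.adj.row r t x j :=
  row_of_eq_combination (fun _ _ => rfl) (fun _ _ _ => ⟨rfl, rfl⟩) x j

lemma vecForm_negIm (L : DiffExpr H) (r : ℕ) (t : ℝ) (x : ℕ → H) :
    L.negIm.vecForm r t x x = ((-(L.vecForm r t x x).im : ℝ) : ℂ) := by
  rw [vecForm_of_row (row_negIm L r t), vecForm_adj]
  apply Complex.ext <;> simp
  ring

lemma negIm_eqOn_adj (L : DiffExpr H) (r : ℕ) (J : Set ℝ) : L.negIm.EqOn L.negIm.adj r J := by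
  refine fun t _ => ⟨fun j _ => ?_, fun j _ _ => ⟨?_, ?_⟩⟩ <;>
  · simp only [negIm, adj, map_add, map_smulₛₗ, ContinuousLinearMap.adjoint_adjoint, map_neg,
      map_div₀, Complex.conj_I, map_ofNat]
    module

lemma row_imQuot_I (L : ℂ → DiffExpr H) (r : ℕ) (t : ℝ) (x : ℕ → H) (j : ℕ) :
    (imQuot L Complex.I).row r t x j = (-1 : ℂ) • (L Complex.I).negIm.row r t x j
      + (0 : ℂ) • (L Complex.I).negIm.row r t x j := by
  have h : (1 / (2 * Complex.I * (1 : ℝ)) : ℂ) = -(Complex.I / 2) := by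
    rw [Complex.ofReal_one, mul_one, one_div, mul_inv, Complex.inv_I]; ring
  refine row_of_eq_combination (fun j _ => ?_) (fun j _ _ => ⟨?_, ?_⟩) x j <;>
  · simp only [imQuot, Complex.I_im, one_ne_zero, if_false, negIm, h]
    module

end Combination

end DiffExpr

end

/-! ### The perturbed family -/

noncomputable section

namespace DiffExpr

variable {H : Type*} [NormedAddCommGroup H] [InnerProductSpace ℂ H]

lemma smoothOn_pencil_zero {l m : DiffExpr H} {r : ℕ} {J : Set ℝ} (hl : l.SmoothOn r J)
    (hm : m.SmoothOn r J) (z : ℂ) : (pencil l m 0 z).SmoothOn r J := by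
  have h : ∀ A C : H →L[ℂ] H, A - z • C - 0 = (1 : ℂ) • A + (-z) • C := fun A C => by module
  exact hl.combination hm fun t _ => ⟨fun _ _ => h _ _, fun _ _ _ => ⟨h _ _, h _ _⟩⟩

variable [CompleteSpace H] {L : ℂ → DiffExpr H} {r : ℕ} {a b : ℝ} {B : Set ℂ}

lemma IsNevanlinnaOn.smoothOn_adj_I (hL : IsNevanlinnaOn L r a b B) :
    (L Complex.I).adj.SmoothOn r (Icc a b) := by
  have h : (-Complex.I) ∈ B := hL.nonreal_subset (by simp)
  have h1 := hL.symm _ h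
  rw [map_neg, Complex.conj_I, neg_neg] at h1
  exact (hL.smooth _ h).congr fun t ht =>
    ⟨fun j hj => ((h1 t ht).1 j hj).symm, fun j h2 hj =>
      ⟨((h1 t ht).2 j h2 hj).1.symm, ((h1 t ht).2 j h2 hj).2.symm⟩⟩

lemma IsNevanlinnaOn.smoothOn_of_eqOn_re (hL : IsNevanlinnaOn L r a b B) {l : DiffExpr H}
    (hl : l.EqOn (L Complex.I).re r (Icc a b)) : l.SmoothOn r (Icc a b) := by
  have hI : Complex.I ∈ B := hL.nonreal_subset (by simp)
  refine SmoothOn.congr ?_ hl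
  exact (hL.smooth _ hI).combination hL.smoothOn_adj_I (c₁ := 1 / 2) (c₂ := 1 / 2) fun t _ =>
    ⟨fun _ _ => smul_add _ _ _, fun _ _ _ => ⟨smul_add _ _ _, smul_add _ _ _⟩⟩

/-- The definiteness condition passes from the family `l - z m` to `L_z`, where `l = Re L_i`. -/
theorem isDefinite_of_isDefinite_pencil_zero {l m : DiffExpr H} {s : ℕ} {B₀ : Set ℂ} (hab : a < b)
    (hr : 0 < r) (hL : IsNevanlinnaOn L r a b B) (hm : IsWeightFor m s L r a b)
    (hl : l.EqOn (L Complex.I).re r (Icc a b))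
    (hlead : ∀ z ∈ B₀, ∀ t ∈ Icc a b, (pencil l m 0 z).LeadingInvertible r t)
    (hdef : IsDefinite (pencil l m 0) m r s a b B₀) : IsDefinite L m r s a b B := by
  obtain ⟨z₀, hz₀, α, hα, β, hβ, hα0, hβ0, δ, hδ, h⟩ := hdef
  have hI : Complex.I ∈ B := hL.nonreal_subset (by simp)
  have hLs := hL.smooth _ hI
  have hls := hL.smoothOn_of_eqOn_re hl
  have hms : m.SmoothOn r (Icc a b) := hm.smooth.of_orderLE hm.order
  have hKs : (L Complex.I).negIm.SmoothOn r (Icc a b) :=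
    hLs.combination hL.smoothOn_adj_I fun t _ => ⟨fun _ _ => rfl, fun _ _ _ => ⟨rfl, rfl⟩⟩
  have hmsym : m.EqOn m.adj r (Icc a b) := EqOn.adj_of_orderLE hm.symm hm.order
  have hlsym : l.EqOn l.adj r (Icc a b) := EqOn.adj_of_eqOn_re hl
  have hmr : ∀ t ∈ Icc a b, ∀ x : ℕ → H, m.vecForm s t x x = m.vecForm r t x x := fun t ht x =>
    vecForm_of_orderLE hm.order hm.le ht x x
  have hr0 : (0 : ℝ) < r := by exact_mod_cast hr
  -- `L_i - (l - z₀ m) = -i K + z₀ m` with `K = -Im L_i`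
  have hLL : ∀ t ∈ Icc a b, ∀ (x : ℕ → H) (j : ℕ),
      (L Complex.I).row r t x j - (pencil l m 0 z₀).row r t x j =
        (-Complex.I) • (L Complex.I).negIm.row r t x j + z₀ • m.row r t x j := by
    intro t ht x j
    have h1 : (pencil l m 0 z₀).row r t x j = (1 : ℂ) • l.row r t x j + (-z₀) • m.row r t x j := by
      have e : ∀ A C : H →L[ℂ] H, A - z₀ • C - 0 = (1 : ℂ) • A + (-z₀) • C := fun A C => by module
      exact row_of_eq_combination (fun _ _ => e _ _) (fun _ _ _ => ⟨e _ _, e _ _⟩) x j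
    have h2 : (L Complex.I).re.row r t x j = (1 / 2 : ℂ) • (L Complex.I).row r t x j
        + (1 / 2 : ℂ) • (L Complex.I).adj.row r t x j :=
      row_of_eq_combination (fun _ _ => smul_add _ _ _)
        (fun _ _ _ => ⟨smul_add _ _ _, smul_add _ _ _⟩) x j
    have h3 : (-Complex.I) * (Complex.I / 2) = 1 / 2 := by
      rw [neg_mul, mul_div_assoc', Complex.I_mul_I]; norm_num
    have h4 : ∀ A A' : H, (-Complex.I) • ((Complex.I / 2) • A + (-(Complex.I / 2)) • A') =
        (1 / 2 : ℂ) • A - (1 / 2 : ℂ) • A' := fun A A' => by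
      rw [smul_add, smul_smul, smul_smul, mul_neg, h3, neg_smul, sub_eq_add_neg]
    rw [h1, row_congr hl ht, h2, row_negIm, h4]
    module
  have hdef₁ : ∀ y : ℝ → H, ContDiffOn ℝ r y (Icc a b) →
      (∀ t ∈ Icc a b, (pencil l m 0 z₀).apply r (Icc a b) y t = 0) →
      δ / r * ‖(pencil l m 0 z₀).phase r (Icc a b) y 0‖ ^ 2 ≤
        ∫ t in α..β, (m.form r (Icc a b) y y t).re := by
    intro y hy hsol
    have h1 : ∀ t ∈ Icc a b, ((imQuot (pencil l m 0) z₀).form r (Icc a b) y y t).re =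
        -(m.form r (Icc a b) y y t).re := by
      intro t ht
      have e : ∀ C : H →L[ℂ] H, -C = (-1 : ℂ) • C + (0 : ℂ) • C := fun C => by module
      have h2 := imQuot_pencil_zero hlsym hmsym z₀ ht
      have h3 := vecForm_of_row (row_of_eq_combination
        (fun j hj => (h2.1 j hj).trans (e _))
        (fun j hj hj' => ⟨(h2.2 j hj hj').1.trans (e _), (h2.2 j hj hj').2.trans (e _)⟩))
        (jet (Icc a b) y t) (jet (Icc a b) y t)
      have h4 := congrArg Complex.re h3
      simp only [zero_mul, add_zero, neg_mul, one_mul, Complex.neg_re] at h4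
      exact h4
    have h2 := h y hy hsol
    have h3 : ∫ t in α..β, ((imQuot (pencil l m 0) z₀).form r (Icc a b) y y t).re =
        ∫ t in α..β, -(m.form r (Icc a b) y y t).re := by
      refine intervalIntegral.integral_congr fun t ht => h1 t ?_
      rw [uIcc_of_le (hα0.trans hβ0)] at ht
      exact ⟨hα.1.trans ht.1, ht.2.trans hβ.2⟩
    rw [h3, intervalIntegral.integral_neg, neg_neg] at h2
    refine le_trans ?_ h2
    rw [div_mul_eq_mul_div, div_le_iff₀ hr0, mul_assoc]
    refine mul_le_mul_of_nonneg_left ?_ hδ.le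
    rw [mul_comm]
    exact norm_phase_sq_le 0
  obtain ⟨δ', hδ', hfin⟩ := exists_norm_phase_sq_le_integral hab hr hα hβ hα0 hβ0 hLs
    (smoothOn_pencil_zero hls hms z₀) hKs hms (hlead z₀ hz₀) (negIm_eqOn_adj _ _ _) hmsym
    (fun t ht x => by rw [← hmr t ht]; exact hm.nonneg t ht x)
    (fun t ht x => by
      have h1 := hm.le_im Complex.I (by simp) t ht x
      rw [Complex.I_im, div_one] at h1
      rw [← hmr t ht, vecForm_negIm, Complex.ofReal_re]
      exact h1) hLL (div_pos hδ hr0) hdef₁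
  refine ⟨Complex.I, hI, α, hα, β, hβ, hα0, hβ0, δ' / r, div_pos hδ' hr0, fun y hy hsol => ?_⟩
  have h1 : ∀ t, -((imQuot L Complex.I).form r (Icc a b) y y t).re =
      ((L Complex.I).negIm.form r (Icc a b) y y t).re := by
    intro t
    have h2 := congrArg Complex.re (vecForm_of_row (row_imQuot_I L r t)
      (jet (Icc a b) y t) (jet (Icc a b) y t))
    simp only [zero_mul, add_zero, neg_mul, one_mul, Complex.neg_re] at h2
    exact neg_eq_iff_eq_neg.2 h2
  rw [← intervalIntegral.integral_neg]
  simp only [h1]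
  refine le_trans ?_ (hfin y hy hsol)
  rw [div_mul_eq_mul_div, div_le_iff₀ hr0, mul_assoc]
  refine mul_le_mul_of_nonneg_left ?_ hδ'.le
  rw [mul_comm]
  exact norm_vec_zero_sq_le hr 0

/-- A continuous family of vectors whose boundary values lie in a nonnegative subspace has a
nonpositive increment of the form of `Re Q`. -/
lemma boundaryFormLimitNonpos_of_continuousOn {a b : ℝ} {E : Type*} [NormedAddCommGroup E]
    [InnerProductSpace ℂ E] {A : ℝ → E →L[ℂ] E} {v : ℝ → E} {z : ℂ} (hab : a < b)
    (hc : ContinuousOn (fun t => (inner ℂ (v t) (A t (v t))).re) (Icc a b))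
    {S : Submodule ℂ (E × E)} (hS : IsNonnegSubspace z.im (A a) (A b) S) (hv : (v a, v b) ∈ S) :
    BoundaryFormLimitNonpos A v a b z := by
  set φ : ℝ → ℝ := fun t => (inner ℂ (v t) (A t (v t))).re with hφ
  refine ⟨(φ b - φ a) / z.im, ?_, ?_⟩
  · have h : 0 ≤ z.im * (φ a - φ b) := hS _ hv
    rcases lt_trichotomy z.im 0 with hz | hz | hz
    · exact div_nonpos_of_nonneg_of_nonpos (by nlinarith) hz.le
    · simp [hz]
    · exact div_nonpos_of_nonpos_of_nonneg (by nlinarith) hz.le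
  · have ha : Tendsto φ (𝓝[>] a) (𝓝 (φ a)) := by
      rw [← nhdsWithin_Ioc_eq_nhdsGT hab]
      exact (hc a (left_mem_Icc.2 hab.le)).mono Ioc_subset_Icc_self
    have hb : Tendsto φ (𝓝[<] b) (𝓝 (φ b)) := by
      rw [← nhdsWithin_Ico_eq_nhdsLT hab]
      exact (hc b (right_mem_Icc.2 hab.le)).mono Ico_subset_Icc_self
    exact ((hb.comp tendsto_snd).sub (ha.comp tendsto_fst)).div_const _

end DiffExpr

end

theorem mainTheorem12 {H : Type*} [NormedAddCommGroup H] [InnerProductSpace ℂ H] [CompleteSpace H]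
    (a b : ℝ) (hab : a < b) (h0 : (0 : ℝ) ∈ Set.Icc a b)
    (r s : ℕ) (hr : 0 < r)
    (l m : DiffExpr H) (n : ℂ → DiffExpr H) (B B₀ : Set ℂ)
    -- the equation `l_z[y] = m[f]`, `l_z = l - z m - n_z`, with `l = Re l_i`
    (hL : DiffExpr.IsNevanlinnaOn (DiffExpr.pencil l m n) r a b B)
    (hm : DiffExpr.IsWeightFor m s (DiffExpr.pencil l m n) r a b)
    (hl : DiffExpr.EqOn l (DiffExpr.pencil l m n Complex.I).re r (Set.Icc a b))
    -- the leading coefficient of `l - z m` is invertible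
    (hB₀ : {z : ℂ | z.im ≠ 0} ⊆ B₀)
    (hlead : ∀ z ∈ B₀, ∀ t ∈ Set.Icc a b, (DiffExpr.pencil l m 0 z).LeadingInvertible r t)
    -- the definiteness condition for `n_z ≡ 0`
    (hdef : DiffExpr.IsDefinite (DiffExpr.pencil l m 0) m r s a b B₀) :
    DiffExpr.IsDefinite (DiffExpr.pencil l m n) m r s a b B ∧
    ∀ 𝓜 𝓝' : ℂ → (HilbPow H r →L[ℂ] HilbPow H r),
      DiffExpr.IsBoundaryPair (DiffExpr.pencil l m n) r a b 𝓜 𝓝' →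
      ∀ z : ℂ, z.im ≠ 0 → ∀ f : ℝ → H, ContDiffOn ℝ s f (Set.Icc a b) →
      ∀ y y₁ : ℝ → H,
        DiffExpr.SolvesBoundaryProblem (DiffExpr.pencil l m 0) m r s a b 𝓜 𝓝' z f y →
        DiffExpr.SolvesBoundaryProblem (DiffExpr.pencil l m n) m r s a b 𝓜 𝓝' z f y₁ →
        DiffExpr.BoundaryFormLimitNonpos
          (fun t => (DiffExpr.pencil l m n z).reQ r t)
          (fun t => (DiffExpr.pencil l m n z).vec m r s (Set.Icc a b) y₁ f t -
            (DiffExpr.pencil l m 0 z).vec m r s (Set.Icc a b) y f t) a b z := by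
  refine ⟨DiffExpr.isDefinite_of_isDefinite_pencil_zero hab hr hL hm hl hlead hdef, ?_⟩
  rintro 𝓜 𝓝' hbp z hz f hf y y₁ ⟨hy, -, h, ha, hb⟩ ⟨hy₁, -, h₁, ha₁, hb₁⟩
  have hJ := uniqueDiffOn_Icc hab
  have hLz := hL.smooth z (hL.nonreal_subset hz)
  have hms : m.SmoothOn r (Icc a b) := hm.smooth.of_orderLE hm.order
  have hc := (DiffExpr.vec_continuousOn hJ hr hLz hm.smooth hm.even hy₁ hf).sub
    (DiffExpr.vec_continuousOn hJ hr
      (DiffExpr.smoothOn_pencil_zero (hL.smoothOn_of_eqOn_re hl) hms z) hm.smooth hm.even hy hf)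
  refine DiffExpr.boundaryFormLimitNonpos_of_continuousOn hab
    (DiffExpr.continuousOn_inner_reQ hLz hc) (hbp.maximal z hz).prop ?_
  refine ⟨h₁ - h, ?_⟩
  rw [ha, hb, ha₁, hb₁, ← map_sub, ← map_sub]
  rfl
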